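/- Let $d>1$ and $n\ge 2$. Write elements of the group $G(d,1,n)=(\mathbb Z/d\mathbb Z)\wr\mathfrak S_n$ as pairs $[\pi;a]$ with $\pi\in\mathfrak S_n$ and $a\in(\mathbb Z/d\mathbb Z)^n$, where $[\pi;a]$ is the $n\times n$ matrix sending $e_j$ to $\omega^{a_j}e_{\pi(j)}$, $\omega=e^{2\pi i/d}$. Let $G=G(d,d,n)$ be the subgroup of elements with $a_1+\dots+a_n=0$. Let $c$ be a Coxeter element of $G$, that is, a conjugate in $G$ of $[(1\,2\cdots n-1)(n);(0,\dots,0,a,-a)]$ for some generator $a$ of $\mathbb Z/d\mathbb Z$; for example $c_{(d,d,n)}=[(1\,2\cdots n-1)(n);(0,\dots,0,1,-1)]$. A factorization $c=u_1\cdots u_k$ with $u_1,\dots,u_k\in G$ is called transitive if the subgroup generated by $u_1,\dots,u_k$ acts transitively on the set $\{\omega^ie_j : 0\le i<d,\ 1\le j\le n\}$. Let $b^{(d)}_{r_1,\dots,r_k}$ be the number of transitive factorizations $c=u_1\cdots u_k$ in $G$ such that the fixed space of $u_i$ in $\mathbb C^n$ has dimension $r_i$ for $i=1,\dots,k$. For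 $p\ge 1$ put $$P_p(x)=(x-(p-1)(d-1))\cdot\prod_{i=0}^{p-2}(x-1-id),$$ and for $p_1,\dots,p_k\ge 0$ put $$M^n_{p_1,\dots,p_k}=\sum_{t=0}^{\min(p_i)}(-1)^t\binom nt\prod_{i=1}^k\binom{n-t}{p_i-t}.$$ Then, as polynomial identities, $$\frac{n}{(n-1)\,|G|}\sum_{r,s\ge0}b^{(d)}_{r,s}x^ry^s=\sum_{p,q\ge1}\binom{n-2}{p-1;\,q-1;\,n-p-q}\frac{P_p(x)}{d^{p-1}p!}\cdot\frac{P_q(y)}{d^{q-1}q!},$$ where $\binom{N}{a;b;N-a-b}$ is the multinomial coefficient $N!/(a!\,b!\,(N-a-b)!)$, which is $0$ if $a+b>N$; and, more generally, for every $k\ge1$, $$\frac{n^k}{|G|^{k-1}}\sum_{r_1,\dots,r_k\ge0}b^{(d)}_{r_1,\dots,r_k}x_1^{r_1}\cdots x_k^{r_k}=\sum_{p_1,\dots,p_k\ge1}M^n_{p_1,\dots,p_k}\prod_{i=1}^k\frac{P_{p_i}(x_i)}{d^{p_i-1}(p_i-1)!}.$$ -/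

import Mathlib

/-- An element `[π; a]` of the group `G(d,1,n)`: a permutation `π` of `n` letters (the underlying
permutation) together with a tuple `a` of weights in `ℤ/d`.  It stands for the generalized
permutation matrix that sends `e_j` to `ω ^ (a j) • e_{π j}`, where `ω = exp (2πi/d)`. -/
@[ext]
structure GenPerm (d n : ℕ) where
  /-- the underlying permutation -/
  perm : Equiv.Perm (Fin n)
  /-- the weights -/
  weight : Fin n → ZMod d

namespace GenPerm

/-- The product `[π; a] · [σ; b] = [πσ; σ(a) + b]`, where `σ(a) j = a (σ j)`. -/
instance instMul (d n : ℕ) : Mul (GenPerm d n) :=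
  ⟨fun u v => ⟨u.perm * v.perm, fun j => u.weight (v.perm j) + v.weight j⟩⟩

instance instOne (d n : ℕ) : One (GenPerm d n) := ⟨⟨1, fun _ => 0⟩⟩

instance instInv (d n : ℕ) : Inv (GenPerm d n) :=
  ⟨fun u => ⟨u.perm⁻¹, fun j => - u.weight (u.perm⁻¹ j)⟩⟩

@[simp] theorem mul_perm {d n : ℕ} (u v : GenPerm d n) : (u * v).perm = u.perm * v.perm := rfl

@[simp] theorem mul_weight {d n : ℕ} (u v : GenPerm d n) (j : Fin n) :
    (u * v).weight j = u.weight (v.perm j) + v.weight j := rfl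

@[simp] theorem one_perm {d n : ℕ} : (1 : GenPerm d n).perm = 1 := rfl

@[simp] theorem one_weight {d n : ℕ} (j : Fin n) : (1 : GenPerm d n).weight j = 0 := rfl

@[simp] theorem inv_perm {d n : ℕ} (u : GenPerm d n) : (u⁻¹).perm = u.perm⁻¹ := rfl

@[simp] theorem inv_weight {d n : ℕ} (u : GenPerm d n) (j : Fin n) :
    (u⁻¹).weight j = - u.weight (u.perm⁻¹ j) := rfl

/-- `GenPerm d n` is the group `G(d,1,n)`. -/
instance instGroup (d n : ℕ) : Group (GenPerm d n) :=
  Group.ofLeftAxioms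
    (fun u v w => by ext j <;> simp [add_assoc])
    (fun u => by ext j <;> simp)
    (fun u => by ext j <;> simp)

/-- The natural action of `G(d,1,n)` on the set of the `d n` vectors `ω ^ i • e_j`; this vector
is encoded as the pair `(j, i)`. -/
instance instMulAction (d n : ℕ) : MulAction (GenPerm d n) (Fin n × ZMod d) where
  smul u x := (u.perm x.1, x.2 + u.weight x.1)
  one_smul x := by
    change ((1 : Equiv.Perm (Fin n)) x.1, x.2 + 0) = x
    simp
  mul_smul u v x := by
    change ((u.perm * v.perm) x.1, x.2 + (u.weight (v.perm x.1) + v.weight x.1)) =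
      (u.perm (v.perm x.1), x.2 + v.weight x.1 + u.weight (v.perm x.1))
    simp [add_assoc, add_comm]

/-- The generalized permutation matrix of `[π; a]`: column `j` has its nonzero entry
`ω ^ (a j)`, `ω = exp (2πi/d)`, in row `π j`. -/
noncomputable def toMatrix {d n : ℕ} (u : GenPerm d n) : Matrix (Fin n) (Fin n) ℂ :=
  Matrix.of fun i j =>
    if i = u.perm j then Complex.exp (2 * Real.pi * Complex.I / d) ^ (u.weight j).val else 0

/-- The dimension of the fixed space `{v ∈ ℂⁿ : w v = v}` of `w`. -/
noncomputable def fixDim {d n : ℕ} (w : GenPerm d n) : ℕ :=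
  Module.finrank ℂ (Module.End.eigenspace (Matrix.toLin' w.toMatrix) 1)

end GenPerm

/-- The group `G(d,d,n)`: the elements of `G(d,1,n)` of total weight `0`, i.e. the generalized
permutation matrices whose nonzero entries multiply to `1`. -/
def Gddn (d n : ℕ) : Subgroup (GenPerm d n) where
  carrier := {u | ∑ j, u.weight j = 0}
  one_mem' := by simp
  mul_mem' {u v} hu hv := by
    have h : ∑ j, u.weight (v.perm j) = ∑ j, u.weight j := Equiv.sum_comp v.perm u.weight
    simp only [Set.mem_ofPred_eq] at hu hv ⊢
    simp [Finset.sum_add_distrib, h, hu, hv]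
  inv_mem' {u} hu := by
    have h : ∑ j, u.weight (u.perm⁻¹ j) = ∑ j, u.weight j := Equiv.sum_comp u.perm⁻¹ u.weight
    simp only [Set.mem_ofPred_eq] at hu ⊢
    simp only [GenPerm.inv_weight, Finset.sum_neg_distrib, h, hu, neg_zero]

/-- The element `[(1 2 ⋯ n-1)(n); (0, …, 0, a, -a)]` of `G(d,d,n)`, for `n ≥ 2`
(the letters `1, …, n` are `0, …, n-1` here).  For `a = 1` it is `c_{(d,d,n)}`. -/
def coxeterElement (d n : ℕ) (hn : 2 ≤ n) (a : ZMod d) : Gddn d n :=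
  ⟨⟨Fin.cycleRange ⟨n - 2, by omega⟩,
    fun j => if (j : ℕ) = n - 2 then a else if (j : ℕ) = n - 1 then -a else 0⟩, by
    obtain ⟨m, rfl⟩ : ∃ m, n = m + 2 := ⟨n - 2, by omega⟩
    change ∑ j : Fin (m + 2), (if (j : ℕ) = m + 2 - 2 then a
      else if (j : ℕ) = m + 2 - 1 then -a else 0) = 0
    rw [Fin.sum_univ_castSucc, Fin.sum_univ_castSucc, Finset.sum_eq_zero]
    · simp
    · intro i _
      have := i.isLt
      rw [if_neg, if_neg]
      · simp only [Fin.val_castSucc]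
        omega
      · simp only [Fin.val_castSucc]
        omega⟩

/-- The Coxeter elements of `G(d,d,n)`: the conjugates in `G(d,d,n)` of
`[(1 2 ⋯ n-1)(n); (0, …, 0, a, -a)]`, where `a` is a cyclic generator of `ℤ/d`. -/
def IsCoxeterElement (d n : ℕ) (hn : 2 ≤ n) (c : Gddn d n) : Prop :=
  ∃ a : (ZMod d)ˣ, IsConj (coxeterElement d n hn a) c

/-- `b_{r_1,…,r_k}`: the number of transitive factorizations `c = u_1 ⋯ u_k` in `G(d,d,n)` in which
`u_i` has fixed space dimension `r_i`.  Transitive: the subgroup generated by the factors acts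
transitively on the set of the `d n` vectors `ω ^ i • e_j`. -/
noncomputable def transFactCount {d n : ℕ} (c : Gddn d n) {k : ℕ} (r : Fin k → ℕ) : ℕ :=
  Nat.card {u : Fin k → Gddn d n //
    (List.ofFn u).prod = c ∧
    MulAction.IsPretransitive (Subgroup.closure (Set.range u)) (Fin n × ZMod d) ∧
    ∀ i, (u i : GenPerm d n).fixDim = r i}

/-- `M^n_{p_1,…,p_k} = ∑_{t=0}^{min p_i} (-1)^t C(n,t) ∏_i C(n-t, p_i-t)` (for `k ≥ 1`). -/
noncomputable def coeffM (n : ℕ) {k : ℕ} (p : Fin k → ℕ) : ℤ :=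
  ∑ t ∈ Finset.range ((⨅ i, p i) + 1),
    (-1) ^ t * (n.choose t : ℤ) * ∏ i, ((n - t).choose (p i - t) : ℤ)

/-- `(x - 1)^{(d)}_p = (x - 1)(x - 1 - d) ⋯ (x - 1 - (p - 1) d)`. -/
noncomputable def stepFalling (d p : ℕ) : Polynomial ℚ :=
  ∏ i ∈ Finset.range p, (Polynomial.X - Polynomial.C (1 + (i : ℚ) * d))

/-- `P_p(x) = (x - (p - 1)(d - 1)) (x - 1)^{(d)}_{p - 1}` for `p ≥ 1`, and `P_0 = 1`. -/
noncomputable def polyP (d : ℕ) : ℕ → Polynomial ℚ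
  | 0 => 1
  | p + 1 => (Polynomial.X - Polynomial.C ((p : ℚ) * ((d : ℚ) - 1))) * stepFalling d p

/-- The multinomial coefficient `N! / (a! b! (N - a - b)!)`, which is `0` if `a + b > N`. -/
def trinomial (N a b : ℕ) : ℚ :=
  if a + b ≤ N then
    (N.factorial : ℚ) / (a.factorial * b.factorial * (N - a - b).factorial)
  else 0

/-! The sums of the theorem run over infinite index sets, but have only finitely many nonzero
terms, by the following facts. -/

theorem GenPerm.fixDim_le {d n : ℕ} (w : GenPerm d n) : w.fixDim ≤ n := by
  have h := Submodule.finrank_le (Module.End.eigenspace (Matrix.toLin' w.toMatrix) 1)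
  simpa [GenPerm.fixDim] using h

theorem transFactCount_eq_zero {d n : ℕ} (c : Gddn d n) {k : ℕ} (r : Fin k → ℕ) (i : Fin k)
    (hi : n < r i) : transFactCount c r = 0 := by
  have : IsEmpty {u : Fin k → Gddn d n //
      (List.ofFn u).prod = c ∧
      MulAction.IsPretransitive (Subgroup.closure (Set.range u)) (Fin n × ZMod d) ∧
      ∀ i, (u i : GenPerm d n).fixDim = r i} :=
    ⟨fun u => absurd (GenPerm.fixDim_le (u.1 i : GenPerm d n)) (by rw [u.2.2.2 i]; omega)⟩
  exact Nat.card_of_isEmpty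

theorem coeffM_eq_zero (n : ℕ) {k : ℕ} (p : Fin k → ℕ) (i : Fin k) (hi : n < p i) :
    coeffM n p = 0 := by
  refine Finset.sum_eq_zero fun t _ => ?_
  rcases le_or_gt t n with ht | ht
  · have : ((n - t).choose (p i - t) : ℤ) = 0 := by
      rw [Nat.choose_eq_zero_of_lt (by omega)]; rfl
    rw [Finset.prod_eq_zero (Finset.mem_univ i) this, mul_zero]
  · rw [Nat.choose_eq_zero_of_lt ht]; simp

/-! The enumeration is done in the symmetric group and then lifted to `G(d,d,n)`.

Symmetric group. The underlying permutation of a Coxeter element fixes one letter and is a cycle on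
the others, so a factorization of it is transitive exactly when some factor moves the fixed letter.
In the group algebra, all factorizations minus those fixing the letter are read off from products of
the central elements `∑ π, x ^ cycles(π) • π`. The sum of the long cycles lives only in the hook
blocks. `HookDecomposition` records its components `K r` there, with no character theory: they are
built by adding one point at a time, diagonalizing the Jucys–Murphy element `starSum none`, whose
eigenvalues are contents of boxes. A hook extends by a box on the arm, on the leg, or at the inner
corner, which has content `0`. On the corner component, all factors and factors fixing the letter
have the same eigenvalue, so it cancels from the difference; only hooks remain. Summing over `r`
telescopes (`alternating_hook_sum`) to the alternating sum in `sum_transitive_factorizations`.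

Lifting. The fixed space dimension of `[π; a]` is the number of cycles of `π` whose weights sum to
zero (`fixDim_eq_card`). For a transitive tuple of permutations, the weight vector of the product
and the cycle weights of the factors are independent apart from one relation on total weights
(`range_liftHom`). Hence the lifts are counted by a product over the factors (`sum_lifts`), and a
factor with `m` cycles contributes `(x + d - 1) ^ m + (d - 1) (x - 1) ^ m` up to powers of `d`.
Transitivity on the `d n` vectors reduces to that on letters because the weight of `c` at its fixed
letter is a unit. So the symmetric group formula is used with each variable at `(x + d - 1) / d` or
`(x - 1) / d`.

Change of basis. Expanding both evaluations by Vandermonde in the binomials of `(x - 1) / d` makes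
them merge into the polynomials `P_p` (`combined_shift_eq_sum`), with coefficients `M`. For `k = 2`
a finite difference turns `M` into a multinomial coefficient (`coeffM_pair`). -/

section TransitiveFactorizations

open Equiv

/-! ### Cycles of a permutation and their number. -/

/-- The set of cycles (including fixed points) of a permutation. -/
def CycleSet {α : Type*} (π : Perm α) : Type _ := Quotient (Perm.SameCycle.setoid π)

namespace CycleSet

variable {α β : Type*} {π : Perm α}

/-- The cycle of a point. -/
def mk (π : Perm α) (x : α) : CycleSet π := Quotient.mk (Perm.SameCycle.setoid π) x

theorem mk_surjective (π : Perm α) : Function.Surjective (mk π) := Quotient.mk_surjective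

theorem mk_eq_mk {x y : α} : mk π x = mk π y ↔ π.SameCycle x y := Quotient.eq

@[simp] theorem mk_apply (x : α) : mk π (π x) = mk π x :=
  mk_eq_mk.2 (Perm.sameCycle_apply_left.2 (Perm.SameCycle.refl π x))

theorem eq_of_invariant {f : α → β} (hf : ∀ x, f (π x) = f x) {x y : α} (h : mk π x = mk π y) :
    f x = f y := by
  obtain ⟨m, rfl⟩ := mk_eq_mk.1 h
  have hinv : ∀ x, f (π⁻¹ x) = f x := fun x => by rw [← hf (π⁻¹ x)]; simp
  have key : ∀ (m : ℤ) (x : α), f x = f ((π ^ m) x) := fun m => by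
    induction m using Int.induction_on with
    | zero => simp
    | succ i ih => intro x; rw [zpow_add_one, Perm.mul_apply, ← ih, hf]
    | pred i ih => intro x; rw [zpow_sub_one, Perm.mul_apply, ← ih, hinv]
  exact key m x

/-- A function invariant under a permutation descends to the set of its cycles. -/
def lift (f : α → β) (hf : ∀ x, f (π x) = f x) : CycleSet π → β :=
  Quotient.lift f fun _ _ h => eq_of_invariant hf (mk_eq_mk.2 h)

@[simp] theorem lift_mk (f : α → β) (hf : ∀ x, f (π x) = f x) (x : α) :
    lift f hf (mk π x) = f x := rfl

instance [Finite α] : Finite (CycleSet π) := Finite.of_surjective _ (mk_surjective π)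

noncomputable instance [Finite α] : Fintype (CycleSet π) := Fintype.ofFinite _

noncomputable instance : DecidableEq (CycleSet π) := Classical.decEq _

end CycleSet

/-- The number of cycles (including fixed points) of a permutation. -/
noncomputable def cycleCount {α : Type*} (π : Perm α) : ℕ := Nat.card (CycleSet π)

theorem cycleCount_eq_of_semiconj {α β : Type*} {π : Perm α} {ρ : Perm β} (e : α ≃ β)
    (h : ∀ x, e (π x) = ρ (e x)) : cycleCount π = cycleCount ρ := by
  have h' : ∀ y, e.symm (ρ y) = π (e.symm y) := fun y => by
    rw [e.symm_apply_eq, h, e.apply_symm_apply]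
  refine Nat.card_congr
    { toFun := CycleSet.lift (fun x => CycleSet.mk ρ (e x)) (fun x => by simp [h])
      invFun := CycleSet.lift (fun y => CycleSet.mk π (e.symm y)) (fun y => by simp [h'])
      left_inv := fun C => ?_
      right_inv := fun C => ?_ }
  · obtain ⟨x, rfl⟩ := CycleSet.mk_surjective _ C
    simp
  · obtain ⟨x, rfl⟩ := CycleSet.mk_surjective _ C
    simp

theorem cycleCount_conj {α : Type*} (g π : Perm α) : cycleCount (g * π * g⁻¹) = cycleCount π :=
  (cycleCount_eq_of_semiconj g fun x => by simp).symm

theorem cycleCount_inv {α : Type*} (π : Perm α) : cycleCount π⁻¹ = cycleCount π := by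
  refine Nat.card_congr
    { toFun := CycleSet.lift (CycleSet.mk π) (fun x => ?_)
      invFun := CycleSet.lift (CycleSet.mk π⁻¹) (fun x => ?_)
      left_inv := fun C => ?_
      right_inv := fun C => ?_ }
  · rw [← CycleSet.mk_apply (π := π) (π⁻¹ x)]; simp
  · rw [← CycleSet.mk_apply (π := π⁻¹) (π x)]; simp
  · obtain ⟨x, rfl⟩ := CycleSet.mk_surjective _ C
    simp
  · obtain ⟨x, rfl⟩ := CycleSet.mk_surjective _ C
    simp

theorem cycleCount_optionCongr {α : Type*} [Finite α] (τ : Perm α) :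
    cycleCount (optionCongr τ : Perm (Option α)) = cycleCount τ + 1 := by
  have e : CycleSet (optionCongr τ : Perm (Option α)) ≃ Option (CycleSet τ) :=
    { toFun := CycleSet.lift (Option.map (CycleSet.mk τ)) (fun x => by cases x <;> simp)
      invFun := fun C => C.elim (CycleSet.mk _ none) (CycleSet.lift
        (fun x => CycleSet.mk _ (some x)) fun x => by
          rw [← CycleSet.mk_apply (some x)]; simp)
      left_inv := fun C => by
        obtain ⟨x, rfl⟩ := CycleSet.mk_surjective _ C
        cases x <;> simp
      right_inv := fun C => by
        rcases C with _ | C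
        · simp
        · obtain ⟨x, rfl⟩ := CycleSet.mk_surjective _ C
          simp }
  rw [cycleCount, Nat.card_congr e, Finite.card_option, cycleCount]

/-- The swap inserts `none` just before `j` in the cycle of `j`, so no cycle is created or merged.
-/
theorem cycleCount_swap_mul_optionCongr {α : Type*} [DecidableEq α] (τ : Perm α) (j : α) :
    cycleCount (swap none (some j) * optionCongr τ : Perm (Option α)) = cycleCount τ := by
  set ρ : Perm (Option α) := swap none (some j) * optionCongr τ with hρ
  have hnone : ρ none = some j := by simp [hρ]
  have hsome : ∀ x, CycleSet.mk ρ (some (τ x)) = CycleSet.mk ρ (some x) := fun x => by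
    by_cases hx : τ x = j
    · rw [hx, ← hnone, CycleSet.mk_apply, ← CycleSet.mk_apply (some x)]
      simp [hρ, hx]
    · rw [← CycleSet.mk_apply (some x)]
      congr 1
      simp [hρ, swap_apply_of_ne_of_ne, hx]
  refine Nat.card_congr
    { toFun := CycleSet.lift (fun x => CycleSet.mk τ (x.getD j)) (fun x => ?_)
      invFun := CycleSet.lift (fun x => CycleSet.mk ρ (some x)) hsome
      left_inv := fun C => ?_
      right_inv := fun C => ?_ }
  · rcases x with _ | x
    · simp [hnone]
    · by_cases hx : τ x = j
      · have : ρ (some x) = none := by simp [hρ, hx]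
        rw [this]
        simp [← hx]
      · have : ρ (some x) = some (τ x) := by simp [hρ, swap_apply_of_ne_of_ne, hx]
        simp [this]
  · obtain ⟨x, rfl⟩ := CycleSet.mk_surjective _ C
    rcases x with _ | x
    · simp only [CycleSet.lift_mk, Option.getD_none]
      rw [← hnone, CycleSet.mk_apply]
    · simp
  · obtain ⟨x, rfl⟩ := CycleSet.mk_surjective _ C
    simp

/-! ### The group algebra of permutations, and the effect of adding a point. -/

section GroupAlgebra

variable {α : Type*}

theorem cycleCount_pos [Finite α] [Nonempty α] (τ : Perm α) : 0 < cycleCount τ := by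
  have : Nonempty (CycleSet τ) := ‹Nonempty α›.map (CycleSet.mk τ)
  exact Nat.card_pos

/-- The rational group algebra of the permutations of `α`. -/
abbrev PermAlg (α : Type*) := MonoidAlgebra ℚ (Perm α)

/-- A permutation as an element of the group algebra. -/
noncomputable abbrev permOf (g : Perm α) : PermAlg α := MonoidAlgebra.of ℚ (Perm α) g

/-- `∑ π, x ^ (number of cycles of π) • π`. -/
noncomputable def cycleEnum (α : Type*) [Fintype α] [DecidableEq α] (x : ℚ) : PermAlg α :=
  ∑ π : Perm α, x ^ cycleCount π • permOf π

/-- The sum of the permutations with exactly one cycle. -/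
noncomputable def longCycleSum (α : Type*) [Fintype α] [DecidableEq α] : PermAlg α :=
  ∑ π : Perm α, (if cycleCount π = 1 then (1 : ℚ) else 0) • permOf π

/-- The sum of the transpositions that move `j`. -/
noncomputable def starSum [Fintype α] [DecidableEq α] (j : α) : PermAlg α :=
  ∑ i : α, if i = j then 0 else permOf (swap i j)

theorem permOf_mul (g h : Perm α) : permOf (g * h) = permOf g * permOf h := map_mul _ _ _

theorem sum_class_comm [Fintype α] [DecidableEq α] {f : Perm α → ℚ}
    (hf : ∀ g π, f (g * π * g⁻¹) = f π) (g : Perm α) :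
    permOf g * ∑ π, f π • permOf π = (∑ π, f π • permOf π) * permOf g := by
  rw [Finset.mul_sum, Finset.sum_mul, ← Equiv.sum_comp (MulAut.conj g).toEquiv
    (fun π => f π • permOf π * permOf g)]
  refine Finset.sum_congr rfl fun π _ => ?_
  simp only [MulEquiv.toEquiv_eq_coe, MulEquiv.coe_toEquiv, MulAut.conj_apply, hf,
    mul_smul_comm, smul_mul_assoc, ← permOf_mul]
  simp [mul_assoc]

theorem cycleEnum_comm [Fintype α] [DecidableEq α] (x : ℚ) (g : Perm α) :
    permOf g * cycleEnum α x = cycleEnum α x * permOf g :=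
  sum_class_comm (fun g π => by rw [cycleCount_conj]) g

theorem longCycleSum_comm [Fintype α] [DecidableEq α] (g : Perm α) :
    permOf g * longCycleSum α = longCycleSum α * permOf g :=
  sum_class_comm (fun g π => by rw [cycleCount_conj]) g

theorem permOf_mul_starSum [Fintype α] [DecidableEq α] (g : Perm α) (j : α) :
    permOf g * starSum j = starSum (g j) * permOf g := by
  rw [starSum, starSum, Finset.mul_sum, Finset.sum_mul, ← Equiv.sum_comp g
    (fun i => (if i = g j then 0 else permOf (swap i (g j))) * permOf g)]
  refine Finset.sum_congr rfl fun i _ => ?_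
  by_cases h : i = j
  · simp [h]
  · rw [if_neg h, if_neg (g.injective.ne h), ← permOf_mul, ← permOf_mul, Equiv.mul_swap_eq_swap_mul]

theorem sum_starSum_comm [Fintype α] [DecidableEq α] (g : Perm α) :
    permOf g * ∑ j : α, starSum j = (∑ j : α, starSum j) * permOf g := by
  rw [Finset.mul_sum, Finset.sum_mul, ← Equiv.sum_comp g (fun j => starSum j * permOf g)]
  exact Finset.sum_congr rfl fun j _ => permOf_mul_starSum g j

theorem comm_of_comm_permOf {y : PermAlg α} (hy : ∀ g, permOf g * y = y * permOf g)
    (a : PermAlg α) : a * y = y * a := by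
  induction a using MonoidAlgebra.induction_on with
  | of g => exact hy g
  | add a b ha hb => rw [add_mul, mul_add, ha, hb]
  | smul r a ha => rw [smul_mul_assoc, mul_smul_comm, ha]

/-- The embedding of permutations of `α` as permutations of `Option α` that fix `none`. -/
def optionCongrHom (α : Type*) : Perm α →* Perm (Option α) where
  toFun τ := optionCongr τ
  map_one' := optionCongr_one
  map_mul' σ τ := by ext x; cases x <;> simp

@[simp] theorem optionCongrHom_apply (τ : Perm α) : optionCongrHom α τ = optionCongr τ := rfl

/-- The embedding of the group algebra of `Perm α` into that of `Perm (Option α)`. -/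
noncomputable def optionEmb (α : Type*) : PermAlg α →ₐ[ℚ] PermAlg (Option α) :=
  MonoidAlgebra.mapDomainAlgHom ℚ ℚ (optionCongrHom α)

@[simp] theorem optionEmb_permOf (τ : Perm α) :
    optionEmb α (permOf τ) = permOf (optionCongr τ) := by
  simp [optionEmb, permOf]

theorem optionEmb_coeff_one (y : PermAlg α) : (optionEmb α y).coeff 1 = y.coeff 1 := by
  have h : Function.Injective (optionCongrHom α) := optionCongr_injective
  have := Finsupp.mapDomain_apply h y.coeff 1
  rw [map_one] at this
  exact this

theorem permOf_mul_optionEmb_coeff_one [DecidableEq α] {g : Perm (Option α)} (hg : g none ≠ none)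
    (y : PermAlg α) : (permOf g * optionEmb α y).coeff 1 = 0 := by
  induction y using MonoidAlgebra.induction_on with
  | of τ =>
    rw [show MonoidAlgebra.of ℚ (Perm α) τ = permOf τ from rfl, optionEmb_permOf, ← permOf_mul]
    have : g * optionCongr τ ≠ 1 := fun h => hg (by simpa using congrArg (fun e => e none) h)
    simp [permOf, this]
  | add a b ha hb =>
    rw [map_add, mul_add, MonoidAlgebra.coeff_add, Finsupp.add_apply, ha, hb, add_zero]
  | smul r a ha => rw [map_smul, mul_smul_comm, MonoidAlgebra.coeff_smul_apply, ha, smul_zero]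

variable [Fintype α] [DecidableEq α]

theorem starSum_none :
    (starSum (none : Option α)) = ∑ j : α, permOf (swap none (some j)) := by
  rw [starSum, Fintype.sum_option]
  simp [swap_comm]

theorem starSum_some (j : α) :
    starSum (some j) = optionEmb α (starSum j) + permOf (swap none (some j)) := by
  rw [starSum, Fintype.sum_option, starSum, map_sum, add_comm]
  congr 1
  refine Finset.sum_congr rfl fun i _ => ?_
  by_cases h : i = j
  · simp [h]
  · rw [if_neg h, if_neg (by simpa using h), optionEmb_permOf, optionCongr_swap]

theorem sum_starSum_option :
    ∑ y : Option α, starSum y =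
      optionEmb α (∑ j, starSum j) + (2 : ℚ) • starSum (none : Option α) := by
  rw [Fintype.sum_option, map_sum]
  simp only [starSum_some, Finset.sum_add_distrib]
  rw [← starSum_none]
  module

theorem starSum_none_mul_optionEmb (y : PermAlg α) :
    starSum (none : Option α) * optionEmb α y = optionEmb α y * starSum (none : Option α) := by
  induction y using MonoidAlgebra.induction_on with
  | of τ =>
    rw [show MonoidAlgebra.of ℚ (Perm α) τ = permOf τ from rfl, optionEmb_permOf,
      permOf_mul_starSum]
    simp
  | add a b ha hb => rw [map_add, mul_add, add_mul, ha, hb]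
  | smul r a ha => rw [map_smul, smul_mul_assoc, mul_smul_comm, ha]

theorem starSum_none_mul_swap (j : α) :
    starSum (none : Option α) * permOf (swap none (some j)) =
      1 + permOf (swap none (some j)) * optionEmb α (starSum j) := by
  have h : starSum (none : Option α) * permOf (swap none (some j)) =
      permOf (swap none (some j)) * starSum (some j) := by
    rw [permOf_mul_starSum, swap_apply_right]
  rw [h, starSum_some, mul_add, ← permOf_mul, swap_mul_self, add_comm]
  simp [permOf, MonoidAlgebra.one_def]

/-- Moving `starSum none` past a swap that moves `none` turns it into a star sum at another point,
which splits into a part inside `Perm α` and the swap itself. The swaps square to `1`, which gives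
the constant term. -/
theorem starSum_none_sq :
    starSum (none : Option α) * starSum (none : Option α) =
      (Fintype.card α : ℚ) • 1 +
        ∑ j : α, permOf (swap none (some j)) * optionEmb α (starSum j) := by
  conv_lhs => rw [starSum_none (α := α)]
  rw [← starSum_none, starSum_none, Finset.mul_sum, ← starSum_none]
  simp only [starSum_none_mul_swap, Finset.sum_add_distrib]
  simp [Nat.cast_smul_eq_nsmul]

theorem sum_perm_option {M : Type*} [AddCommMonoid M] (f : Perm (Option α) → M) :
    ∑ π, f π = ∑ τ : Perm α, (f (optionCongr τ) +
      ∑ j : α, f (swap none (some j) * optionCongr τ)) := by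
  rw [← Equiv.sum_comp Equiv.Perm.decomposeOption.symm f, Fintype.sum_prod_type,
    Fintype.sum_option, Finset.sum_comm, ← Finset.sum_add_distrib]
  simp [← Perm.one_def]

/-- One step of the Jucys factorization: the new point is either a fixed point, giving the factor
`x`, or is inserted into an old cycle. -/
theorem cycleEnum_option (x : ℚ) :
    cycleEnum (Option α) x =
      (x • 1 + starSum (none : Option α)) * optionEmb α (cycleEnum α x) := by
  rw [cycleEnum, sum_perm_option, cycleEnum, map_sum, Finset.mul_sum]
  refine Finset.sum_congr rfl fun τ _ => ?_
  simp only [cycleCount_optionCongr, cycleCount_swap_mul_optionCongr, map_smul, optionEmb_permOf,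
    starSum_none, add_mul, mul_smul_comm, smul_mul_assoc, one_mul, Finset.sum_mul, permOf_mul,
    Finset.smul_sum, pow_succ, smul_add, smul_smul]

/-- A long cycle cannot fix the new point when there are other points, so only the insertions
survive. -/
theorem longCycleSum_option [Nonempty α] :
    longCycleSum (Option α) = starSum (none : Option α) * optionEmb α (longCycleSum α) := by
  rw [longCycleSum, sum_perm_option, longCycleSum, map_sum, Finset.mul_sum]
  refine Finset.sum_congr rfl fun τ _ => ?_
  have h : ¬ (cycleCount τ + 1 = 1) := by have := cycleCount_pos τ; omega
  simp only [cycleCount_optionCongr, cycleCount_swap_mul_optionCongr, map_smul, optionEmb_permOf,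
    starSum_none, mul_smul_comm, Finset.sum_mul, permOf_mul, Finset.smul_sum, h, if_false,
    zero_smul, zero_add]

end GroupAlgebra

/-! ### The hook components of the sum of the long cycles. -/

/-- A decomposition of the sum of the long cycles into its components `K r` in the blocks of the
group algebra that belong to the hooks `(N - r, 1 ^ r)`, where `N` is the size of `α`. -/
structure HookDecomposition (α : Type*) [Fintype α] [DecidableEq α] (K : ℕ → PermAlg α) :
    Prop where
  sum_eq : ∑ r ∈ Finset.range (Fintype.card α), K r = longCycleSum α
  eq_zero : ∀ r, Fintype.card α ≤ r → K r = 0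
  comm : ∀ r g, permOf g * K r = K r * permOf g
  -- The roots `N - 1 - r` and `-r` of this quadratic are the contents of the boxes at the ends of
  -- the arm and the leg.
  sq : ∀ r j, starSum j * (starSum j * K r) =
    ((Fintype.card α : ℚ) - 1 - 2 * r) • (starSum j * K r) +
      ((r : ℚ) * (Fintype.card α - 1 - r)) • K r
  -- A product over the boxes of the hook, whose contents run from `-r` to `N - 1 - r`.
  eigen : ∀ r x, cycleEnum α x * K r =
    (∏ j ∈ Finset.range (Fintype.card α), (x - r + j)) • K r
  -- Each transposition occurs twice on the left, so the eigenvalue is twice the sum of the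
  -- contents.
  total : ∀ r, (∑ j : α, starSum j) * K r =
    ((Fintype.card α : ℚ) * ((Fintype.card α : ℚ) - 1 - 2 * r)) • K r
  coeff_one : ∀ r, (K r).coeff 1 =
    (-1) ^ r * ((Fintype.card α - 1).choose r : ℚ) / Fintype.card α

namespace HookDecomposition

variable {α : Type*} [Fintype α] [DecidableEq α] {K : ℕ → PermAlg α}

/-- The component of `K r` in the hook obtained by adding a box to the arm. -/
noncomputable def arm (K : ℕ → PermAlg α) (r : ℕ) : PermAlg (Option α) :=
  ((Fintype.card α : ℚ) + 1)⁻¹ • (starSum none * (starSum none * optionEmb α (K r)) +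
    ((r : ℚ) + 1) • (starSum none * optionEmb α (K r)))

/-- The component of `K r` in the hook obtained by adding a box to the leg. -/
noncomputable def leg (K : ℕ → PermAlg α) (r : ℕ) : PermAlg (Option α) :=
  ((Fintype.card α : ℚ) + 1)⁻¹ • (((Fintype.card α : ℚ) - r) • (starSum none * optionEmb α (K r)) -
    starSum none * (starSum none * optionEmb α (K r)))

theorem arm_add_leg (K : ℕ → PermAlg α) (r : ℕ) :
    arm K r + leg K r = starSum none * optionEmb α (K r) := by
  have hN : ((Fintype.card α : ℚ) + 1) ≠ 0 := by positivity
  simp only [arm, leg]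
  rw [← smul_add, inv_smul_eq_iff₀ hN]
  module

/-- Contents of the three possible new boxes are the roots of `X³ = (N - 1 - 2r) X² + (N - r)(r + 1)
X`: `N - r` on the arm, `-(r + 1)` on the leg, `0` at the corner. The relation follows from
`starSum_none_sq` and the quadratic relation for the old star sums; `total` evaluates their sum.
Consequently `arm` and `leg` are the eigencomponents for the two nonzero roots. -/
theorem starSum_none_cube (hK : HookDecomposition α K) (r : ℕ) :
    starSum none * (starSum none * (starSum none * optionEmb α (K r))) =
      ((Fintype.card α : ℚ) - 1 - 2 * r) • (starSum none * (starSum none * optionEmb α (K r))) +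
      (((Fintype.card α : ℚ) - r) * (r + 1)) • (starSum none * optionEmb α (K r)) := by
  have h2 : starSum none * (starSum none * optionEmb α (K r)) =
      (Fintype.card α : ℚ) • optionEmb α (K r) +
        ∑ j : α, permOf (swap none (some j)) * optionEmb α (starSum j * K r) := by
    rw [← mul_assoc, starSum_none_sq, add_mul, smul_mul_assoc, one_mul, Finset.sum_mul]
    simp only [mul_assoc, map_mul]
  have h3 : starSum none * (∑ j : α, permOf (swap none (some j)) *
        optionEmb α (starSum j * K r)) =
      optionEmb α ((∑ j, starSum j) * K r) + ∑ j : α, permOf (swap none (some j)) *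
        optionEmb α (starSum j * (starSum j * K r)) := by
    rw [Finset.mul_sum, Finset.sum_mul, map_sum, ← Finset.sum_add_distrib]
    refine Finset.sum_congr rfl fun j _ => ?_
    rw [← mul_assoc, starSum_none_mul_swap, add_mul, one_mul, mul_assoc, map_mul, map_mul, map_mul]
  have h4 : ∑ j : α, permOf (swap none (some j)) * optionEmb α (starSum j * (starSum j * K r)) =
      ((Fintype.card α : ℚ) - 1 - 2 * r) • ∑ j : α, permOf (swap none (some j)) *
        optionEmb α (starSum j * K r) +
      ((r : ℚ) * (Fintype.card α - 1 - r)) • (starSum none * optionEmb α (K r)) := by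
    rw [starSum_none, Finset.sum_mul, Finset.smul_sum, Finset.smul_sum, ← Finset.sum_add_distrib]
    refine Finset.sum_congr rfl fun j _ => ?_
    rw [hK.sq, map_add, map_smul, map_smul, mul_add, mul_smul_comm, mul_smul_comm]
  rw [h2, mul_add, mul_smul_comm, h3, h4, hK.total, map_smul]
  module

theorem starSum_none_mul_arm (hK : HookDecomposition α K) (r : ℕ) :
    starSum none * arm K r = ((Fintype.card α : ℚ) - r) • arm K r := by
  simp only [arm, mul_smul_comm, mul_add, hK.starSum_none_cube]
  module

theorem starSum_none_mul_leg (hK : HookDecomposition α K) (r : ℕ) :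
    starSum none * leg K r = (-((r : ℚ) + 1)) • leg K r := by
  simp only [leg, mul_smul_comm, mul_sub, hK.starSum_none_cube]
  module

theorem optionEmb_mul_arm {y : PermAlg α} {r : ℕ} {c : ℚ} (h : y * K r = c • K r) :
    optionEmb α y * arm K r = c • arm K r := by
  have h1 : optionEmb α y * optionEmb α (K r) = c • optionEmb α (K r) := by
    rw [← map_mul, h, map_smul]
  simp only [arm, mul_smul_comm, mul_add]
  simp only [← mul_assoc, ← starSum_none_mul_optionEmb]
  simp only [mul_assoc, ← starSum_none_mul_optionEmb]
  simp only [h1, mul_smul_comm]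
  module

theorem optionEmb_mul_leg {y : PermAlg α} {r : ℕ} {c : ℚ} (h : y * K r = c • K r) :
    optionEmb α y * leg K r = c • leg K r := by
  have h1 : optionEmb α y * optionEmb α (K r) = c • optionEmb α (K r) := by
    rw [← map_mul, h, map_smul]
  have h2 : leg K r = starSum none * optionEmb α (K r) - arm K r := by
    rw [← arm_add_leg, add_sub_cancel_left]
  rw [h2, mul_sub, optionEmb_mul_arm h, ← mul_assoc, ← starSum_none_mul_optionEmb, mul_assoc, h1,
    mul_smul_comm, smul_sub]

theorem cycleEnum_mul_arm (hK : HookDecomposition α K) (r : ℕ) (x : ℚ) :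
    cycleEnum (Option α) x * arm K r =
      ((∏ j ∈ Finset.range (Fintype.card α), (x - r + j)) * (x + (Fintype.card α - r))) •
        arm K r := by
  rw [cycleEnum_option, mul_assoc, optionEmb_mul_arm (hK.eigen r x), mul_smul_comm, add_mul,
    hK.starSum_none_mul_arm, smul_mul_assoc, one_mul]
  module

theorem cycleEnum_mul_leg (hK : HookDecomposition α K) (r : ℕ) (x : ℚ) :
    cycleEnum (Option α) x * leg K r =
      ((∏ j ∈ Finset.range (Fintype.card α), (x - r + j)) * (x - (r + 1))) • leg K r := by
  rw [cycleEnum_option, mul_assoc, optionEmb_mul_leg (hK.eigen r x), mul_smul_comm, add_mul,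
    hK.starSum_none_mul_leg, smul_mul_assoc, one_mul]
  module

theorem starSum_none_mul_coeff_one (y : PermAlg α) :
    (starSum none * optionEmb α y).coeff 1 = 0 := by
  rw [starSum_none, Finset.sum_mul, MonoidAlgebra.coeff_sum, Finsupp.finsetSum_apply]
  exact Finset.sum_eq_zero fun j _ => permOf_mul_optionEmb_coeff_one (by simp) y

/-- In `starSum_none_sq` every term except the constant one moves `none`, so only the constant term
can reach the identity. -/
theorem starSum_none_mul_mul_coeff_one (y : PermAlg α) :
    (starSum none * (starSum none * optionEmb α y)).coeff 1 = Fintype.card α * y.coeff 1 := by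
  rw [← mul_assoc, starSum_none_sq, add_mul, smul_mul_assoc, one_mul, Finset.sum_mul,
    MonoidAlgebra.coeff_add, Finsupp.add_apply, MonoidAlgebra.coeff_smul_apply,
    optionEmb_coeff_one, MonoidAlgebra.coeff_sum, Finsupp.finsetSum_apply,
    Finset.sum_eq_zero fun j _ => ?_, add_zero, smul_eq_mul]
  rw [mul_assoc, ← map_mul]
  exact permOf_mul_optionEmb_coeff_one (by simp) _

theorem arm_coeff_one (K : ℕ → PermAlg α) (r : ℕ) :
    (arm K r).coeff 1 = Fintype.card α / (Fintype.card α + 1) * (K r).coeff 1 := by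
  rw [arm, MonoidAlgebra.coeff_smul_apply, MonoidAlgebra.coeff_add, Finsupp.add_apply,
    MonoidAlgebra.coeff_smul_apply, starSum_none_mul_coeff_one, starSum_none_mul_mul_coeff_one]
  simp only [smul_eq_mul]
  ring

theorem leg_coeff_one (K : ℕ → PermAlg α) (r : ℕ) :
    (leg K r).coeff 1 = -(Fintype.card α / (Fintype.card α + 1) * (K r).coeff 1) := by
  have h := congrArg (fun y => y.coeff 1) (arm_add_leg K r)
  simp only [MonoidAlgebra.coeff_add, Finsupp.add_apply, starSum_none_mul_coeff_one,
    arm_coeff_one] at h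
  linarith

/-- The hook components over `Option α`. -/
noncomputable def next (K : ℕ → PermAlg α) : ℕ → PermAlg (Option α)
  | 0 => arm K 0
  | r + 1 => arm K (r + 1) + leg K r

theorem sum_next (hK : HookDecomposition α K) [Nonempty α] :
    ∑ r ∈ Finset.range (Fintype.card (Option α)), next K r = longCycleSum (Option α) := by
  have harm : arm K (Fintype.card α) = 0 := by simp [arm, hK.eq_zero _ le_rfl]
  rw [Fintype.card_option, Finset.sum_range_succ', longCycleSum_option, ← hK.sum_eq, map_sum,
    Finset.mul_sum]
  simp only [next, ← arm_add_leg, Finset.sum_add_distrib]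
  have h := Finset.sum_range_succ' (arm K) (Fintype.card α)
  rw [Finset.sum_range_succ, harm, add_zero] at h
  rw [h]
  abel

theorem next_total (hK : HookDecomposition α K) (r : ℕ) :
    (∑ y : Option α, starSum y) * next K r =
      ((Fintype.card (Option α) : ℚ) * ((Fintype.card (Option α) : ℚ) - 1 - 2 * r)) •
        next K r := by
  have h1 : ∀ r, (∑ y : Option α, starSum y) * arm K r =
      (((Fintype.card α : ℚ) + 1) * (Fintype.card α - 2 * r)) • arm K r := fun r => by
    rw [sum_starSum_option, add_mul, optionEmb_mul_arm (hK.total r), smul_mul_assoc,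
      hK.starSum_none_mul_arm]
    module
  have h2 : ∀ r, (∑ y : Option α, starSum y) * leg K r =
      (((Fintype.card α : ℚ) + 1) * (Fintype.card α - 2 * (r + 1))) • leg K r := fun r => by
    rw [sum_starSum_option, add_mul, optionEmb_mul_leg (hK.total r), smul_mul_assoc,
      hK.starSum_none_mul_leg]
    module
  rw [Fintype.card_option]
  rcases r with _ | r
  · simp only [next, h1]
    push_cast
    module
  · simp only [next, mul_add, h1, h2]
    push_cast
    module

theorem next_eq_zero (hK : HookDecomposition α K) (r : ℕ) (hr : Fintype.card (Option α) ≤ r) :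
    next K r = 0 := by
  rw [Fintype.card_option] at hr
  obtain ⟨s, rfl⟩ : ∃ s, r = s + 1 := ⟨r - 1, by omega⟩
  simp [next, arm, leg, hK.eq_zero s (by omega), hK.eq_zero (s + 1) (by omega)]

/-- Central by interpolation: the sum `D` of the star sums is central and has distinct eigenvalues
on the components, so a Lagrange polynomial in `D` applied to the central element `longCycleSum`
isolates the `r`-th component up to a nonzero scalar. -/
theorem next_comm (hK : HookDecomposition α K) [Nonempty α] (r : ℕ) (g : Perm (Option α)) :
    permOf g * next K r = next K r * permOf g := by
  rcases le_or_gt (Fintype.card (Option α)) r with hr | hr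
  · simp [hK.next_eq_zero r hr]
  set D : PermAlg (Option α) := ∑ y : Option α, starSum y with hD
  set M := Fintype.card (Option α) with hM
  set ev : ℕ → ℚ := fun s => (M : ℚ) * ((M : ℚ) - 1 - 2 * s) with hev
  set p : Polynomial ℚ := ∏ s ∈ (Finset.range M).erase r,
    (Polynomial.X - Polynomial.C (ev s)) with hp
  have hM0 : (M : ℚ) ≠ 0 := by
    rw [hM, Fintype.card_option]; positivity
  have happly : ∀ (q : Polynomial ℚ) s, Polynomial.aeval D q * next K s =
      q.eval (ev s) • next K s := fun q s => by
    induction q using Polynomial.induction_on' with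
    | add q₁ q₂ h₁ h₂ => rw [map_add, add_mul, h₁, h₂, Polynomial.eval_add, add_smul]
    | monomial m c =>
      rw [Polynomial.aeval_monomial, Polynomial.eval_monomial, mul_assoc]
      have : D ^ m * next K s = ev s ^ m • next K s := by
        induction m with
        | zero => simp
        | succ m ih =>
          rw [pow_succ, mul_assoc, hK.next_total, mul_smul_comm, ih, smul_smul, pow_succ, mul_comm]
      rw [this, mul_smul_comm, ← Algebra.smul_def, smul_smul, mul_comm]
  have hsum : Polynomial.aeval D p * longCycleSum (Option α) = p.eval (ev r) • next K r := by
    rw [← hK.sum_next, Finset.mul_sum, Finset.sum_eq_single r]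
    · exact happly p r
    · intro s hs hsr
      rw [happly, hp, Polynomial.eval_prod, Finset.prod_eq_zero (i := s), zero_smul]
      · exact Finset.mem_erase.2 ⟨hsr, hs⟩
      · simp
    · intro h
      exact absurd (Finset.mem_range.2 hr) h
  have hpr : p.eval (ev r) ≠ 0 := by
    rw [hp, Polynomial.eval_prod, Finset.prod_ne_zero_iff]
    intro s hs
    simp only [Polynomial.eval_sub, Polynomial.eval_X, Polynomial.eval_C, hev, ← mul_sub]
    refine mul_ne_zero hM0 fun h => (Finset.mem_erase.1 hs).1 ?_
    have : (s : ℚ) = r := by linarith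
    exact_mod_cast this
  have hD' : ∀ y : PermAlg (Option α), Commute y D := fun y =>
    comm_of_comm_permOf sum_starSum_comm y
  have hcomm : Commute (permOf g) (Polynomial.aeval D p) := by
    induction p using Polynomial.induction_on' with
    | add q₁ q₂ h₁ h₂ => rw [map_add]; exact h₁.add_right h₂
    | monomial m c =>
      rw [Polynomial.aeval_monomial]
      exact (Algebra.commute_algebraMap_right c _).mul_right ((hD' _).pow_right m)
  have hnext : next K r = (p.eval (ev r))⁻¹ • (Polynomial.aeval D p * longCycleSum (Option α)) := by
    rw [hsum, smul_smul, inv_mul_cancel₀ hpr, one_smul]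
  rw [hnext, mul_smul_comm, smul_mul_assoc, ← mul_assoc, hcomm.eq, mul_assoc, longCycleSum_comm,
    mul_assoc]

theorem next_sq_none (hK : HookDecomposition α K) (r : ℕ) :
    starSum none * (starSum none * next K r) =
      ((Fintype.card (Option α) : ℚ) - 1 - 2 * r) • (starSum none * next K r) +
        ((r : ℚ) * (Fintype.card (Option α) - 1 - r)) • next K r := by
  rw [Fintype.card_option]
  rcases r with _ | r
  · simp only [next, hK.starSum_none_mul_arm, mul_smul_comm]
    push_cast
    module
  · simp only [next, hK.starSum_none_mul_arm, hK.starSum_none_mul_leg, mul_smul_comm, mul_add]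
    push_cast
    module

/-- At `none` the relation holds since the arm and leg parts have the two roots as eigenvalues.
Centrality of the component transports it to any other point by conjugation. -/
theorem next_sq (hK : HookDecomposition α K) [Nonempty α] (r : ℕ) (y : Option α) :
    starSum y * (starSum y * next K r) =
      ((Fintype.card (Option α) : ℚ) - 1 - 2 * r) • (starSum y * next K r) +
        ((r : ℚ) * (Fintype.card (Option α) - 1 - r)) • next K r := by
  set g : Perm (Option α) := swap none y with hg
  have hgy : starSum y * permOf g = permOf g * starSum none := by
    rw [permOf_mul_starSum, hg, swap_apply_left]
  have hcancel : ∀ v w : PermAlg (Option α), v * permOf g = w * permOf g → v = w := by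
    intro v w h
    have := congrArg (· * permOf g) h
    simpa [mul_assoc, ← permOf_mul, hg, MonoidAlgebra.one_def.symm] using this
  apply hcancel
  simp only [add_mul, smul_mul_assoc, mul_assoc, ← hK.next_comm r g]
  simp only [← mul_assoc, hgy]
  simp only [mul_assoc]
  rw [hK.next_sq_none, mul_add, mul_smul_comm, mul_smul_comm]

theorem next_eigen (hK : HookDecomposition α K) (r : ℕ) (x : ℚ) :
    cycleEnum (Option α) x * next K r =
      (∏ j ∈ Finset.range (Fintype.card (Option α)), (x - r + j)) • next K r := by
  have h1 : ∀ r : ℕ, (∏ j ∈ Finset.range (Fintype.card α), (x - r + j)) *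
      (x + (Fintype.card α - r)) =
      ∏ j ∈ Finset.range (Fintype.card (Option α)), (x - r + j) := fun r => by
    rw [Fintype.card_option, Finset.prod_range_succ]
    ring
  rcases r with _ | r
  · rw [next, hK.cycleEnum_mul_arm, h1]
  · have h2 : (∏ j ∈ Finset.range (Fintype.card α), (x - r + j)) * (x - (r + 1)) =
        ∏ j ∈ Finset.range (Fintype.card (Option α)), (x - ((r + 1 : ℕ) : ℚ) + j) := by
      rw [Fintype.card_option, Finset.prod_range_succ']
      push_cast
      congr 1
      · exact Finset.prod_congr rfl fun j _ => by ring
      · ring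
    rw [next, mul_add, hK.cycleEnum_mul_arm, hK.cycleEnum_mul_leg, h1, h2, smul_add]

/-- The arm and leg contributions combine by Pascal's rule. -/
theorem next_coeff_one (hK : HookDecomposition α K) [Nonempty α] (r : ℕ) :
    (next K r).coeff 1 = (-1) ^ r * ((Fintype.card (Option α) - 1).choose r : ℚ) /
      Fintype.card (Option α) := by
  obtain ⟨m, hm⟩ : ∃ m, Fintype.card α = m + 1 :=
    ⟨Fintype.card α - 1, by have := Fintype.card_pos (α := α); omega⟩
  have hm' : ((m : ℚ) + 1) ≠ 0 := by positivity
  have hm'' : ((m : ℚ) + 1 + 1) ≠ 0 := by positivity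
  rw [Fintype.card_option]
  rcases r with _ | r
  · rw [next, arm_coeff_one, hK.coeff_one, hm]
    simp
    field_simp
  · rw [next, MonoidAlgebra.coeff_add, Finsupp.add_apply, arm_coeff_one, leg_coeff_one,
      hK.coeff_one, hK.coeff_one, hm]
    simp only [Nat.add_sub_cancel, Nat.choose_succ_succ]
    push_cast
    field_simp
    ring

theorem next_spec (hK : HookDecomposition α K) [Nonempty α] :
    HookDecomposition (Option α) (next K) :=
  ⟨hK.sum_next, hK.next_eq_zero, hK.next_comm, hK.next_sq, hK.next_eigen, hK.next_total,
    hK.next_coeff_one⟩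

theorem unit : HookDecomposition Unit (fun r => if r = 0 then 1 else 0) := by
  have hs : ∀ j : Unit, starSum j = 0 := fun j => by simp [starSum]
  have hc : ∀ π : Perm Unit, cycleCount π = 1 := fun π => by
    have : Subsingleton (CycleSet π) := (CycleSet.mk_surjective π).subsingleton
    have : Nonempty (CycleSet π) := ⟨CycleSet.mk π ()⟩
    exact Nat.card_unique
  have hone : (1 : PermAlg Unit) = ∑ π : Perm Unit, permOf π := by
    simp [MonoidAlgebra.one_def, permOf]
  have hz : ∀ x, cycleEnum Unit x = x • 1 := fun x => by
    simp [cycleEnum, hc, hone]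
  refine ⟨?_, ?_, ?_, ?_, ?_, ?_, ?_⟩
  · simp [longCycleSum, hc, hone]
  · intro r hr
    simp at hr
    simp [show r ≠ 0 by omega]
  · intro r g
    split_ifs <;> simp
  · intro r j
    rcases r with _ | r <;> simp [hs]
  · intro r x
    rcases r with _ | r <;> simp [hz]
  · intro r
    rcases r with _ | r <;> simp [hs]
  · intro r
    rcases r with _ | r <;> simp

end HookDecomposition

/-! ### Existence of the hook components, and the number of long cycles. -/

/-- The type with `m + 1` elements obtained from `Unit` by adding `m` points one at a time. -/
def IterOption : ℕ → Type
  | 0 => Unit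
  | m + 1 => Option (IterOption m)

namespace IterOption

instance instFintype : ∀ m, Fintype (IterOption m)
  | 0 => inferInstanceAs (Fintype Unit)
  | m + 1 => letI := instFintype m; inferInstanceAs (Fintype (Option (IterOption m)))

instance instDecidableEq : ∀ m, DecidableEq (IterOption m)
  | 0 => inferInstanceAs (DecidableEq Unit)
  | m + 1 => letI := instDecidableEq m; inferInstanceAs (DecidableEq (Option (IterOption m)))

instance instNonempty : ∀ m, Nonempty (IterOption m)
  | 0 => inferInstanceAs (Nonempty Unit)
  | m + 1 => inferInstanceAs (Nonempty (Option (IterOption m)))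

theorem card (m : ℕ) : Fintype.card (IterOption m) = m + 1 := by
  induction m with
  | zero => exact Fintype.card_unit
  | succ m ih => exact (Fintype.card_option (α := IterOption m)).trans (by rw [ih])

theorem exists_hookDecomposition (m : ℕ) : ∃ K, HookDecomposition (IterOption m) K := by
  induction m with
  | zero => exact ⟨_, HookDecomposition.unit⟩
  | succ m ih =>
    obtain ⟨K, hK⟩ := ih
    exact ⟨_, hK.next_spec⟩

theorem sum_longCycle (m : ℕ) :
    ∑ π : Perm (IterOption m), (if cycleCount π = 1 then (1 : ℚ) else 0) = m.factorial := by
  induction m with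
  -- On one point the identity is the only permutation, so the sum is the coefficient of `1` in `K
  -- 0`.
  | zero =>
    obtain ⟨K, hK⟩ := exists_hookDecomposition 0
    have h := hK.coeff_one 0
    have hsum := hK.sum_eq
    rw [card, Finset.sum_range_one] at hsum
    rw [hsum] at h
    have hu : ∀ π : Perm (IterOption 0), π = 1 := fun π => by
      have : Subsingleton (IterOption 0) := inferInstanceAs (Subsingleton Unit)
      ext x; exact Subsingleton.elim _ _
    have : (longCycleSum (IterOption 0)).coeff 1 =
        ∑ π : Perm (IterOption 0), (if cycleCount π = 1 then (1 : ℚ) else 0) := by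
      rw [longCycleSum, MonoidAlgebra.coeff_sum, Finsupp.finsetSum_apply]
      refine Finset.sum_congr rfl fun π _ => ?_
      rw [hu π]
      split_ifs <;> simp [permOf]
    rw [← this, h, card]
    simp
  | succ m ih =>
    have h : ∀ τ : Perm (IterOption m), ¬ (cycleCount τ + 1 = 1) := fun τ => by
      have := cycleCount_pos τ; omega
    refine (sum_perm_option (α := IterOption m)
      (fun π => if cycleCount π = 1 then (1 : ℚ) else 0)).trans ?_
    simp only [cycleCount_optionCongr, cycleCount_swap_mul_optionCongr, h, if_false, zero_add,
      Finset.sum_const, Finset.card_univ, card]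
    rw [← Finset.smul_sum, ih, Nat.factorial_succ]
    simp

end IterOption

/-! ### Factorizations as coefficients in the group algebra. -/

section Factorizations

variable {α : Type*} [Fintype α] [DecidableEq α]

theorem prod_ofFn_sum {k : ℕ} (w : Fin k → Perm α → ℚ) :
    (List.ofFn fun i => ∑ π, w i π • permOf π).prod =
      ∑ π : Fin k → Perm α, (∏ i, w i (π i)) • permOf (List.ofFn π).prod := by
  have h := (MultilinearMap.mkPiAlgebraFin ℚ k (PermAlg α)).map_sum
    (fun i π => w i π • permOf π)
  simp only [MultilinearMap.map_smul_univ, MultilinearMap.mkPiAlgebraFin_apply] at h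
  rw [h]
  refine Finset.sum_congr rfl fun π _ => ?_
  rw [permOf, map_list_prod, List.map_ofFn]
  rfl

theorem prod_ofFn_sum_coeff {k : ℕ} (w : Fin k → Perm α → ℚ) (g : Perm α) :
    (List.ofFn fun i => ∑ π, w i π • permOf π).prod.coeff g =
      ∑ π : Fin k → Perm α, if (List.ofFn π).prod = g then ∏ i, w i (π i) else 0 := by
  rw [prod_ofFn_sum, MonoidAlgebra.coeff_sum, Finsupp.finsetSum_apply]
  refine Finset.sum_congr rfl fun π _ => ?_
  simp [permOf, Finsupp.single_apply]

theorem prod_ofFn_mul_of_eigen {R : Type*} [Ring R] [Algebra ℚ R] {k : ℕ} {A : Fin k → R}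
    {c : Fin k → ℚ} {v : R} (h : ∀ i, A i * v = c i • v) :
    (List.ofFn A).prod * v = (∏ i, c i) • v := by
  induction k with
  | zero => simp
  | succ k ih =>
    rw [List.ofFn_succ, List.prod_cons, mul_assoc, ih (fun i => h i.succ), mul_smul_comm, h,
      smul_smul, Fin.prod_univ_succ, mul_comm]

theorem prod_ofFn_comm {R : Type*} [Ring R] {k : ℕ} {A : Fin k → R} {v : R}
    (h : ∀ i, v * A i = A i * v) : v * (List.ofFn A).prod = (List.ofFn A).prod * v :=
  Commute.list_prod_right _ _ fun a ha => by
    obtain ⟨i, rfl⟩ := (List.mem_ofFn' _ _).1 ha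
    exact h i

theorem isConj_of_cycleCount_eq_one {σ τ : Perm α} (hσ : cycleCount σ = 1)
    (hτ : cycleCount τ = 1) : IsConj σ τ := by
  -- `IsCycle` excludes the identity, so a single point is treated apart.
  rcases subsingleton_or_nontrivial α with hα | hα
  · rw [Subsingleton.elim σ τ]
  have key : ∀ ρ : Perm α, cycleCount ρ = 1 → ρ.IsCycle ∧ ρ.support = Finset.univ := by
    intro ρ hρ
    have hsub : Subsingleton (CycleSet ρ) := (Nat.card_eq_one_iff_unique.1 hρ).1
    have hsame : ∀ x y, ρ.SameCycle x y := fun x y =>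
      CycleSet.mk_eq_mk.1 (Subsingleton.elim _ _)
    have hmove : ∀ x, ρ x ≠ x := fun x hx => by
      obtain ⟨y, hy⟩ := exists_ne x
      exact hy ((hsame x y).eq_of_left hx).symm
    obtain ⟨x⟩ := (inferInstance : Nonempty α)
    exact ⟨⟨x, hmove x, fun y _ => hsame x y⟩, by ext y; simp [hmove y]⟩
  rw [(key σ hσ).1.isConj_iff (key τ hτ).1, (key σ hσ).2, (key τ hτ).2]

/-- Averaging a conjugation-invariant element over the long cycles. -/
theorem coeff_mul_longCycleSum {Y : PermAlg (Option α)}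
    (hY : ∀ g : Perm α, permOf (optionCongr g) * Y = Y * permOf (optionCongr g))
    {σ : Perm α} (hσ : cycleCount σ = 1) :
    (Y * optionEmb α (longCycleSum α)).coeff 1 =
      (∑ π : Perm α, if cycleCount π = 1 then (1 : ℚ) else 0) * Y.coeff (optionCongr σ) := by
  have hone : ∀ τ : Perm α, optionCongr τ⁻¹ = (optionCongr τ)⁻¹ := fun τ =>
    map_inv (optionCongrHom α) τ
  have h1 : (Y * optionEmb α (longCycleSum α)).coeff 1 =
      ∑ π : Perm α, (if cycleCount π = 1 then (1 : ℚ) else 0) * Y.coeff (optionCongr π⁻¹) := by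
    rw [longCycleSum, map_sum, Finset.mul_sum, MonoidAlgebra.coeff_sum, Finsupp.finsetSum_apply]
    refine Finset.sum_congr rfl fun π _ => ?_
    rw [map_smul, optionEmb_permOf, mul_smul_comm, MonoidAlgebra.coeff_smul_apply, hone]
    simp [permOf, MonoidAlgebra.coeff_mul_single_apply]
  rw [h1, Finset.sum_mul]
  refine Finset.sum_congr rfl fun π _ => ?_
  split_ifs with hπ
  -- The inverse of a long cycle is again a long cycle, hence conjugate to `σ`; the invariance of
  -- `Y` equates the two coefficients.
  · obtain ⟨g, hg⟩ := isConj_iff.1 (isConj_of_cycleCount_eq_one hσ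
      ((cycleCount_inv π).trans hπ))
    have h2 := congrArg (fun y => y.coeff (optionCongr g * optionCongr σ)) (hY g)
    simp only [permOf, MonoidAlgebra.of_apply, MonoidAlgebra.coeff_mul_single_apply,
      MonoidAlgebra.coeff_single_mul_apply, one_mul, mul_one, inv_mul_cancel_left] at h2
    rw [h2, ← hg]
    congr 2
    change optionCongrHom α _ = _
    simp [map_mul, hone]
  · simp

end Factorizations

/-! ### Factorizations of a long cycle with one extra point. -/

namespace HookDecomposition

variable {α : Type*} [Fintype α] [DecidableEq α] {K : ℕ → PermAlg α}

/-- The component of `K r` in the shape obtained by adding a box of content zero to the hook. -/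
noncomputable def corner (K : ℕ → PermAlg α) (r : ℕ) : PermAlg (Option α) :=
  optionEmb α (K r) - ((Fintype.card α : ℚ) - r)⁻¹ • arm K r + ((r : ℚ) + 1)⁻¹ • leg K r

/-- Dividing `arm` and `leg` by their eigenvalues and removing them from `optionEmb α (K r)` leaves
the part of content zero. -/
theorem starSum_none_mul_corner (hK : HookDecomposition α K) {r : ℕ} (hr : r < Fintype.card α) :
    starSum none * corner K r = 0 := by
  have h1 : ((Fintype.card α : ℚ) - r) ≠ 0 := sub_ne_zero.2 (by exact_mod_cast hr.ne')
  have h2 : ((r : ℚ) + 1) ≠ 0 := by positivity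
  rw [corner, mul_add, mul_sub, mul_smul_comm, mul_smul_comm, hK.starSum_none_mul_arm,
    hK.starSum_none_mul_leg, smul_smul, smul_smul, inv_mul_cancel₀ h1, mul_neg,
    inv_mul_cancel₀ h2, ← arm_add_leg]
  module

/-- The eigenvalue equals that of `x • optionEmb α (cycleEnum α x)`, the enumerator of permutations
fixing `none`. This coincidence removes the non-hook shapes from the count. -/
theorem cycleEnum_mul_corner (hK : HookDecomposition α K) {r : ℕ} (hr : r < Fintype.card α)
    (x : ℚ) : cycleEnum (Option α) x * corner K r =
      (x * ∏ j ∈ Finset.range (Fintype.card α), (x - r + j)) • corner K r := by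
  have h : optionEmb α (cycleEnum α x) * corner K r =
      (∏ j ∈ Finset.range (Fintype.card α), (x - r + j)) • corner K r := by
    rw [corner, mul_add, mul_sub, mul_smul_comm, mul_smul_comm,
      optionEmb_mul_arm (hK.eigen r x), optionEmb_mul_leg (hK.eigen r x), ← map_mul, hK.eigen,
      map_smul]
    module
  rw [cycleEnum_option, mul_assoc, h, mul_smul_comm, add_mul, hK.starSum_none_mul_corner hr,
    smul_mul_assoc, one_mul, add_zero, smul_smul, mul_comm]

theorem optionEmb_eq (K : ℕ → PermAlg α) (r : ℕ) : optionEmb α (K r) =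
    ((Fintype.card α : ℚ) - r)⁻¹ • arm K r - ((r : ℚ) + 1)⁻¹ • leg K r + corner K r := by
  rw [corner]
  abel

end HookDecomposition

/-- The `A` terms telescope to their two ends, which the hypotheses turn into the missing terms `t =
0` and `t = N + 1` of the sum of `B`. -/
theorem alternating_hook_sum (N : ℕ) (A B : ℕ → ℚ) (h0 : A 0 = B 0) (hN : A N = B (N + 1)) :
    ∑ r ∈ Finset.range N, ((-1) ^ r * (N.choose r : ℚ) * A r +
        (-1) ^ r * (N.choose (r + 1) : ℚ) * A (r + 1) -
        (-1) ^ r * ((N + 1).choose (r + 1) : ℚ) * B (r + 1)) =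
      ∑ t ∈ Finset.range (N + 2), (-1) ^ t * ((N + 1).choose t : ℚ) * B t := by
  have h := Finset.sum_range_sub' (fun r => (-1) ^ r * (N.choose r : ℚ) * A r) N
  rw [Finset.sum_range_succ, Finset.sum_range_succ']
  simp only [pow_zero, Nat.choose_zero_right, Nat.choose_self, Nat.cast_one, h0, hN] at h ⊢
  rw [Finset.sum_congr rfl (g := fun r => ((-1 : ℚ) ^ r * (N.choose r : ℚ) * A r -
    (-1) ^ (r + 1) * (N.choose (r + 1) : ℚ) * A (r + 1)) +
    (-1) ^ (r + 1) * ((N + 1).choose (r + 1) : ℚ) * B (r + 1)) (fun r _ => by ring),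
    Finset.sum_add_distrib, h]
  ring

theorem sum_fixing_none {α : Type*} [Fintype α] [DecidableEq α] (x : ℚ) :
    ∑ π : Perm (Option α), (if π none = none then x ^ cycleCount π else 0) • permOf π =
      x • optionEmb α (cycleEnum α x) := by
  rw [sum_perm_option, cycleEnum, map_sum, Finset.smul_sum]
  refine Finset.sum_congr rfl fun τ _ => ?_
  rw [Finset.sum_eq_zero fun j _ => by simp, map_smul, optionEmb_permOf, smul_smul,
    cycleCount_optionCongr, pow_succ']
  simp

/-- Contribution of one hook to the factorizations that move `none`. The corner parts of the two
products cancel, so the coefficient of `1` in `corner` is never needed; the coefficients in `arm`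
and `leg`, divided by the contents, give the binomials. -/
theorem HookDecomposition.coeff_one_mul_sub {α : Type*} [Fintype α] [DecidableEq α] [Nonempty α]
    {K : ℕ → PermAlg α} (hK : HookDecomposition α K) {r : ℕ} (hr : r < Fintype.card α) {k : ℕ}
    (x : Fin k → ℚ) :
    (Fintype.card α * (Fintype.card α + 1) : ℚ) *
      (((List.ofFn fun i => cycleEnum (Option α) (x i)).prod * optionEmb α (K r)).coeff 1 -
        ((List.ofFn fun i => x i • optionEmb α (cycleEnum α (x i))).prod *
          optionEmb α (K r)).coeff 1) =
      (-1) ^ r * ((Fintype.card α).choose r : ℚ) *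
          ∏ i, ∏ j ∈ Finset.range (Fintype.card α + 1), (x i - r + j) +
        (-1) ^ r * ((Fintype.card α).choose (r + 1) : ℚ) *
          ∏ i, ∏ j ∈ Finset.range (Fintype.card α + 1), (x i - (r + 1 : ℕ) + j) -
        (-1) ^ r * ((Fintype.card α + 1).choose (r + 1) : ℚ) *
          ∏ i, (x i * ∏ j ∈ Finset.range (Fintype.card α), (x i - (r + 1 : ℕ) + 1 + j)) := by
  have harm : ∀ x : ℚ, (∏ j ∈ Finset.range (Fintype.card α), (x - r + j)) *
      (x + (Fintype.card α - r)) = ∏ j ∈ Finset.range (Fintype.card α + 1), (x - r + j) :=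
    fun x => by rw [Finset.prod_range_succ]; ring
  have hleg : ∀ x : ℚ, (∏ j ∈ Finset.range (Fintype.card α), (x - r + j)) * (x - (r + 1)) =
      ∏ j ∈ Finset.range (Fintype.card α + 1), (x - (r + 1 : ℕ) + j) := fun x => by
    rw [Finset.prod_range_succ']
    push_cast
    congr 1
    · exact Finset.prod_congr rfl fun j _ => by ring
    · ring
  have hcor : ∀ x : ℚ, ∏ j ∈ Finset.range (Fintype.card α), (x - (r + 1 : ℕ) + 1 + j) =
      ∏ j ∈ Finset.range (Fintype.card α), (x - r + j) := fun x =>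
    Finset.prod_congr rfl fun j _ => by push_cast; ring
  have hY2 : (List.ofFn fun i => x i • optionEmb α (cycleEnum α (x i))).prod *
      optionEmb α (K r) = (∏ i, (x i * ∏ j ∈ Finset.range (Fintype.card α), (x i - r + j))) •
        optionEmb α (K r) :=
    prod_ofFn_mul_of_eigen fun i => by
      rw [smul_mul_assoc, ← map_mul, hK.eigen, map_smul, smul_smul]
  have hY1 : (List.ofFn fun i => cycleEnum (Option α) (x i)).prod * optionEmb α (K r) =
      ((Fintype.card α : ℚ) - r)⁻¹ • (∏ i, ((∏ j ∈ Finset.range (Fintype.card α),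
        (x i - r + j)) * (x i + (Fintype.card α - r)))) • arm K r -
      ((r : ℚ) + 1)⁻¹ • (∏ i, ((∏ j ∈ Finset.range (Fintype.card α), (x i - r + j)) *
        (x i - (r + 1)))) • leg K r +
      (∏ i, (x i * ∏ j ∈ Finset.range (Fintype.card α), (x i - r + j))) • corner K r := by
    rw [optionEmb_eq K r, mul_add, mul_sub, mul_smul_comm, mul_smul_comm,
      prod_ofFn_mul_of_eigen (fun i => hK.cycleEnum_mul_arm r (x i)),
      prod_ofFn_mul_of_eigen (fun i => hK.cycleEnum_mul_leg r (x i)),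
      prod_ofFn_mul_of_eigen (fun i => hK.cycleEnum_mul_corner hr (x i))]
  rw [hY2, hY1, optionEmb_eq K r]
  simp only [harm, hleg, hcor, MonoidAlgebra.coeff_add, MonoidAlgebra.coeff_sub,
    MonoidAlgebra.coeff_smul, Finsupp.add_apply, Finsupp.sub_apply, Finsupp.smul_apply,
    smul_eq_mul, arm_coeff_one, leg_coeff_one, hK.coeff_one]
  obtain ⟨m, hm⟩ : ∃ m, Fintype.card α = m + 1 :=
    ⟨Fintype.card α - 1, by have := Fintype.card_pos (α := α); omega⟩
  rw [hm] at hr ⊢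
  have hr' : ((m : ℚ) + 1 - r) ≠ 0 := by
    have : ((r : ℚ)) < m + 1 := by exact_mod_cast hr
    linarith
  have hr1 : ((r : ℚ) + 1) ≠ 0 := by positivity
  have hm1 : ((m : ℚ) + 1) ≠ 0 := by positivity
  have hm2 : ((m : ℚ) + 1 + 1) ≠ 0 := by positivity
  have c1 : ((m + 1).choose r : ℚ) = (m + 1) / (m + 1 - r) * (m.choose r : ℚ) := by
    rw [div_mul_eq_mul_div, eq_div_iff hr']
    have h := Nat.choose_mul_succ_eq m r
    have h' : ((m.choose r * (m + 1) : ℕ) : ℚ) = ((m + 1).choose r * (m + 1 - r) : ℕ) := by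
      exact_mod_cast h
    rw [Nat.cast_mul, Nat.cast_mul, Nat.cast_sub hr.le] at h'
    push_cast at h'
    linarith
  have c2 : ((m + 1).choose (r + 1) : ℚ) = (m + 1) / (r + 1) * (m.choose r : ℚ) := by
    rw [div_mul_eq_mul_div, eq_div_iff hr1]
    exact_mod_cast (Nat.add_one_mul_choose_eq m r).symm
  have c3 : ((m + 1 + 1).choose (r + 1) : ℚ) =
      (m + 1) / (m + 1 - r) * (m.choose r : ℚ) + (m + 1) / (r + 1) * (m.choose r : ℚ) := by
    rw [Nat.choose_succ_succ, Nat.cast_add, c1, c2]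
  rw [c1, c2, c3]
  simp only [Nat.add_sub_cancel]
  push_cast
  generalize (∏ i, ∏ j ∈ Finset.range (m + 1 + 1), (x i - r + j)) = A
  generalize (∏ i, ∏ j ∈ Finset.range (m + 1 + 1), (x i - (r + 1) + j)) = B
  generalize (∏ i, x i * ∏ j ∈ Finset.range (m + 1), (x i - r + j)) = C
  generalize (m.choose r : ℚ) = c
  generalize ((-1 : ℚ) ^ r) = e
  field_simp
  ring

/-- Enumeration of the factorizations of a long cycle on `α`, as a permutation of `Option α`,
into `k` factors that do not all fix `none`. -/
theorem sum_factorizations_option {α : Type*} [Fintype α] [DecidableEq α] [Nonempty α]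
    {K : ℕ → PermAlg α} (hK : HookDecomposition α K) {σ : Perm α} (hσ : cycleCount σ = 1) {k : ℕ}
    (x : Fin k → ℚ) :
    (∑ π : Perm α, if cycleCount π = 1 then (1 : ℚ) else 0) *
      (Fintype.card α * (Fintype.card α + 1)) *
      (∑ π : Fin k → Perm (Option α),
        if (List.ofFn π).prod = optionCongr σ ∧ ¬ ∀ i, π i none = none then
          ∏ i, x i ^ cycleCount (π i) else 0) =
      ∑ t ∈ Finset.range (Fintype.card α + 2), (-1) ^ t * ((Fintype.card α + 1).choose t : ℚ) *
        ∏ i, (x i * ∏ j ∈ Finset.range (Fintype.card α), (x i - t + 1 + j)) := by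
  set Y₁ := (List.ofFn fun i => cycleEnum (Option α) (x i)).prod with hY₁
  set Y₂ := (List.ofFn fun i => x i • optionEmb α (cycleEnum α (x i))).prod with hY₂
  have h₁ : Y₁.coeff (optionCongr σ) = ∑ π : Fin k → Perm (Option α),
      if (List.ofFn π).prod = optionCongr σ then ∏ i, x i ^ cycleCount (π i) else 0 :=
    prod_ofFn_sum_coeff (fun i π => x i ^ cycleCount π) _
  have h₂ : Y₂.coeff (optionCongr σ) = ∑ π : Fin k → Perm (Option α),
      if (List.ofFn π).prod = optionCongr σ then
        ∏ i, (if π i none = none then x i ^ cycleCount (π i) else 0) else 0 := by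
    rw [hY₂]
    simp only [← sum_fixing_none]
    exact prod_ofFn_sum_coeff
      (fun i (π : Perm (Option α)) => if π none = none then x i ^ cycleCount π else 0) _
  have hdiff : (∑ π : Fin k → Perm (Option α),
        if (List.ofFn π).prod = optionCongr σ ∧ ¬ ∀ i, π i none = none then
          ∏ i, x i ^ cycleCount (π i) else 0) =
      Y₁.coeff (optionCongr σ) - Y₂.coeff (optionCongr σ) := by
    rw [h₁, h₂, ← Finset.sum_sub_distrib]
    refine Finset.sum_congr rfl fun π _ => ?_
    rw [Finset.prod_ite_zero]
    by_cases hp : (List.ofFn π).prod = optionCongr σ <;>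
      by_cases hf : ∀ i, π i none = none <;> simp [hp, hf]
  have hc₁ := coeff_mul_longCycleSum (Y := Y₁)
    (fun g => prod_ofFn_comm fun i => cycleEnum_comm _ _) hσ
  have hc₂ := coeff_mul_longCycleSum (Y := Y₂) (fun g => prod_ofFn_comm fun i => by
    rw [mul_smul_comm, smul_mul_assoc, ← optionEmb_permOf, ← map_mul, ← map_mul,
      cycleEnum_comm]) hσ
  have hsum : ∀ Y : PermAlg (Option α), (Y * optionEmb α (longCycleSum α)).coeff 1 =
      ∑ r ∈ Finset.range (Fintype.card α), (Y * optionEmb α (K r)).coeff 1 := fun Y => by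
    rw [← hK.sum_eq, map_sum, Finset.mul_sum, MonoidAlgebra.coeff_sum, Finsupp.finsetSum_apply]
  -- Here `A r` is the product of the eigenvalues on the hook of leg length `r` over the enlarged
  -- set, and `B t` is the product of the corner eigenvalues for `r = t - 1`. They agree at both
  -- ends because the hook is then a single row or column.
  rw [← alternating_hook_sum (Fintype.card α)
    (fun r => ∏ i, ∏ j ∈ Finset.range (Fintype.card α + 1), (x i - r + j)), ← Finset.sum_congr rfl
    (fun r hr => hK.coeff_one_mul_sub (Finset.mem_range.1 hr) x), ← Finset.mul_sum,
    Finset.sum_sub_distrib, ← hsum, ← hsum, ← hY₁, ← hY₂, hc₁, hc₂, hdiff]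
  · ring
  · refine Finset.prod_congr rfl fun i _ => ?_
    rw [Finset.prod_range_succ', mul_comm]
    congr 1
    · simp
    · exact Finset.prod_congr rfl fun j _ => by push_cast; ring
  · refine Finset.prod_congr rfl fun i _ => ?_
    rw [Finset.prod_range_succ, mul_comm]
    congr 1
    · ring
    · exact Finset.prod_congr rfl fun j _ => by push_cast; ring

/-! ### Transitive factorizations of an `(n - 1)`-cycle in the symmetric group. -/

theorem prod_ofFn_mem_closure {G : Type*} [Group G] {k : ℕ} (u : Fin k → G) :
    (List.ofFn u).prod ∈ Subgroup.closure (Set.range u) := by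
  refine Subgroup.list_prod_mem _ fun g hg => ?_
  obtain ⟨i, rfl⟩ := (List.mem_ofFn' _ _).1 hg
  exact Subgroup.subset_closure ⟨i, rfl⟩

/-- The generated group contains `ς`, which already connects all points other than `b`; one factor
moving `b` joins it to them. -/
theorem isPretransitive_closure_iff {β : Type*} [Nontrivial β] {k : ℕ} {π : Fin k → Perm β}
    {ς : Perm β} {b : β} (hς : ∀ x y, x ≠ b → y ≠ b → ς.SameCycle x y)
    (hprod : (List.ofFn π).prod = ς) :
    MulAction.IsPretransitive (Subgroup.closure (Set.range π)) β ↔ ¬ ∀ i, π i b = b := by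
  constructor
  · intro h hfix
    obtain ⟨y, hy⟩ := exists_ne b
    obtain ⟨g, hg⟩ := h.exists_smul_eq b y
    have hle : Subgroup.closure (Set.range π) ≤ MulAction.stabilizer (Perm β) b := by
      rw [Subgroup.closure_le]
      rintro _ ⟨i, rfl⟩
      exact hfix i
    exact hy (hg.symm.trans (hle g.2))
  · intro h
    obtain ⟨i, hi⟩ := not_forall.1 h
    have hςmem : ς ∈ Subgroup.closure (Set.range π) := by
      rw [← hprod]
      exact prod_ofFn_mem_closure π
    rw [MulAction.isPretransitive_iff_base b]
    intro y
    by_cases hy : y = b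
    · exact ⟨1, by simp [hy]⟩
    · obtain ⟨m, hm⟩ := hς (π i b) y hi hy
      exact ⟨⟨ς ^ m * π i, mul_mem (zpow_mem hςmem m) (Subgroup.subset_closure ⟨i, rfl⟩)⟩, hm⟩

/-- Enumeration of the transitive factorizations of a permutation of `n` letters with a fixed
point `b` and an `(n - 1)`-cycle, by the numbers of cycles of the factors. -/
theorem sum_transitive_factorizations {n : ℕ} (hn : 2 ≤ n) {ς : Perm (Fin n)} {b : Fin n}
    (hb : ς b = b) (hς : ∀ x y, x ≠ b → y ≠ b → ς.SameCycle x y) {k : ℕ} (x : Fin k → ℚ) :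
    (n.factorial : ℚ) * (∑ π : Fin k → Perm (Fin n),
        open Classical in if (List.ofFn π).prod = ς ∧
          MulAction.IsPretransitive (Subgroup.closure (Set.range π)) (Fin n) then
          ∏ i, x i ^ cycleCount (π i) else 0) =
      ∑ t ∈ Finset.range (n + 1), (-1) ^ t * (n.choose t : ℚ) *
        ∏ i, (x i * ∏ j ∈ Finset.range (n - 1), (x i - t + 1 + j)) := by
  classical
  obtain ⟨m, rfl⟩ : ∃ m, n = m + 2 := ⟨n - 2, by omega⟩
  have hcard : Fintype.card (Fin (m + 2)) = Fintype.card (Option (IterOption m)) := by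
    rw [Fintype.card_option, IterOption.card, Fintype.card_fin]
  obtain ⟨e, he⟩ : ∃ e : Fin (m + 2) ≃ Option (IterOption m), e b = none := by
    obtain ⟨e₀⟩ := Fintype.card_eq.1 hcard
    exact ⟨e₀.trans (swap (e₀ b) none), by simp⟩
  have he' : e.symm none = b := by rw [← he, e.symm_apply_apply]
  let E : Perm (Fin (m + 2)) ≃* Perm (Option (IterOption m)) := e.permCongrHom
  have hE : ∀ π y, E π y = e (π (e.symm y)) := fun π y => rfl
  obtain ⟨σ, hσ⟩ : ∃ σ : Perm (IterOption m), optionCongr σ = E ς := by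
    refine ⟨removeNone (E ς), ?_⟩
    rw [map_equiv_removeNone, hE, he', hb, he, swap_self]
    rfl
  have hσ1 : cycleCount σ = 1 := by
    refine Nat.card_eq_one_iff_unique.2 ⟨⟨fun C D => ?_⟩,
      (IterOption.instNonempty m).map (CycleSet.mk σ)⟩
    obtain ⟨y, rfl⟩ := CycleSet.mk_surjective _ C
    obtain ⟨z, rfl⟩ := CycleSet.mk_surjective _ D
    rw [CycleSet.mk_eq_mk]
    have hne : ∀ y : IterOption m, e.symm (some y) ≠ b := fun y h => by
      rw [← he', e.symm.apply_eq_iff_eq] at h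
      cases h
    obtain ⟨l, hl⟩ := hς _ _ (hne y) (hne z)
    refine ⟨l, ?_⟩
    have h1 : (E ς ^ l) (some y) = some z := by
      rw [← map_zpow, hE, hl, e.apply_symm_apply]
    rw [← hσ, ← optionCongrHom_apply, ← map_zpow] at h1
    simpa using h1
  obtain ⟨K, hK⟩ := IterOption.exists_hookDecomposition m
  have key := sum_factorizations_option hK hσ1 x
  rw [IterOption.sum_longCycle, IterOption.card] at key
  have hfact : ((m + 2).factorial : ℚ) = m.factorial * ((m + 1 : ℕ) * ((m + 1 : ℕ) + 1)) := by
    rw [Nat.factorial_succ, Nat.factorial_succ]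
    push_cast
    ring
  rw [hfact]
  refine Eq.trans ?_ key
  congr 1
  rw [← Equiv.sum_comp (Equiv.piCongrRight fun _ : Fin k => E.toEquiv)]
  refine Finset.sum_congr rfl fun π _ => ?_
  have hp : (List.ofFn fun i => E (π i)).prod = E (List.ofFn π).prod := by
    rw [map_list_prod, List.map_ofFn]
    rfl
  have hprod : (List.ofFn fun i => E (π i)).prod = optionCongr σ ↔ (List.ofFn π).prod = ς := by
    rw [hp, hσ, E.injective.eq_iff]
  have hfix : (∀ i, E (π i) none = none) ↔ ∀ i, π i b = b := forall_congr' fun i => by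
    rw [hE, he', ← he, e.apply_eq_iff_eq]
  have hcyc : ∀ i, cycleCount (E (π i)) = cycleCount (π i) := fun i =>
    (cycleCount_eq_of_semiconj e fun y => by rw [hE, e.symm_apply_apply]).symm
  have hiff : ((List.ofFn fun i => E (π i)).prod = optionCongr σ ∧
      ¬ ∀ i, E (π i) none = none) ↔ ((List.ofFn π).prod = ς ∧
        MulAction.IsPretransitive (Subgroup.closure (Set.range π)) (Fin (m + 2))) := by
    rw [hprod, hfix]
    exact and_congr_right fun h => (isPretransitive_closure_iff hς h).symm
  change _ = if (List.ofFn fun i => E (π i)).prod = optionCongr σ ∧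
      ¬ ∀ i, E (π i) none = none then ∏ i, x i ^ cycleCount (E (π i)) else 0
  simp only [hiff, hcyc]

/-! ### Cycle weights and coboundaries. -/

section CycleWeight

variable {α A : Type*} [Fintype α] [AddCommGroup A]

/-- The sums of a weight function over the cycles of a permutation. -/
noncomputable def cycleWeight (π : Perm α) : (α → A) →+ (CycleSet π → A) where
  toFun a C := ∑ j with CycleSet.mk π j = C, a j
  map_zero' := by ext C; simp
  map_add' a b := by ext C; simp [Finset.sum_add_distrib]

theorem cycleWeight_apply (π : Perm α) (a : α → A) (C : CycleSet π) :
    cycleWeight π a C = ∑ j with CycleSet.mk π j = C, a j := rfl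

theorem cycleWeight_single [DecidableEq α] (π : Perm α) (j : α) (t : A) :
    cycleWeight π (Pi.single j t) = Pi.single (CycleSet.mk π j) t := by
  ext C
  simp [cycleWeight_apply, Pi.single_apply, eq_comm]

theorem sum_cycleWeight (π : Perm α) (a : α → A) : ∑ C, cycleWeight π a C = ∑ j, a j :=
  Finset.sum_fiberwise Finset.univ (CycleSet.mk π) a

/-- A weight function all of whose cycle sums vanish is a coboundary. -/
theorem exists_potential [DecidableEq α] (π : Perm α) {a : α → A} (ha : cycleWeight π a = 0) :
    ∃ φ : α → A, ∀ j, φ (π j) = φ j + a j := by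
  let δ : (α → A) →+ (α → A) :=
    { toFun := fun φ j => φ (π j) - φ j
      map_zero' := by ext; simp
      map_add' := fun φ ψ => by ext; simp; abel }
  let q := QuotientAddGroup.mk' δ.range
  -- Modulo coboundaries a weight can be moved along its cycle, so the class of `a` depends only on
  -- the cycle sums.
  have hinv : ∀ t j, q (Pi.single (π j) t) = q (Pi.single j t) := fun t j => by
    rw [eq_comm, ← sub_eq_zero, ← map_sub]
    refine (QuotientAddGroup.eq_zero_iff _).2 ⟨Pi.single (π j) t, ?_⟩
    ext i
    simp [δ, Pi.single_apply]
  have hq : q a = 0 := by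
    have h1 : q a = ∑ j, q (Pi.single j (a j)) := by
      rw [← map_sum, Finset.univ_sum_single]
    rw [h1, ← Finset.sum_fiberwise Finset.univ (CycleSet.mk π)]
    refine Finset.sum_eq_zero fun C _ => ?_
    obtain ⟨i, rfl⟩ := CycleSet.mk_surjective _ C
    have h2 : ∀ j ∈ Finset.univ.filter (fun j => CycleSet.mk π j = CycleSet.mk π i),
        q (Pi.single j (a j)) = (q.comp (AddMonoidHom.single (fun _ : α => A) i)) (a j) :=
      fun j hj => CycleSet.eq_of_invariant (f := fun l => q (Pi.single l (a j))) (hinv (a j))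
        (Finset.mem_filter.1 hj).2
    rw [Finset.sum_congr rfl h2, ← map_sum, ← cycleWeight_apply, ha, Pi.zero_apply, map_zero]
  obtain ⟨φ, hφ⟩ := (QuotientAddGroup.eq_zero_iff _).1 hq
  refine ⟨φ, fun j => ?_⟩
  rw [← hφ]
  simp [δ]

end CycleWeight

/-! ### The fixed space dimension as a number of cycles. -/

section FixedSpace

variable {d n : ℕ}

/-- The character `t ↦ ω ^ t` of `ℤ/d`, where `ω = exp (2πi/d)`. -/
noncomputable def rootChar (d : ℕ) (t : ZMod d) : ℂ :=
  Complex.exp (2 * Real.pi * Complex.I / d) ^ t.val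

theorem rootChar_zero [NeZero d] : rootChar d 0 = 1 := by simp [rootChar]

theorem rootChar_add [NeZero d] (s t : ZMod d) :
    rootChar d (s + t) = rootChar d s * rootChar d t := by
  have h := Complex.isPrimitiveRoot_exp d (NeZero.ne d)
  rw [rootChar, rootChar, rootChar, ZMod.val_add, ← pow_add]
  conv_rhs => rw [← pow_mod_orderOf, ← h.eq_orderOf]

theorem rootChar_ne_zero (t : ZMod d) : rootChar d t ≠ 0 := pow_ne_zero _ (Complex.exp_ne_zero _)

theorem rootChar_eq_one [NeZero d] {t : ZMod d} (h : rootChar d t = 1) : t = 0 := by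
  have hp := Complex.isPrimitiveRoot_exp d (NeZero.ne d)
  rw [← ZMod.val_eq_zero]
  exact Nat.eq_zero_of_dvd_of_lt ((hp.pow_eq_one_iff_dvd _).1 h) (ZMod.val_lt t)

theorem rootChar_sum [NeZero d] {ι : Type*} (s : Finset ι) (f : ι → ZMod d) :
    rootChar d (∑ i ∈ s, f i) = ∏ i ∈ s, rootChar d (f i) := by
  classical
  induction s using Finset.induction_on with
  | empty => simp [rootChar_zero]
  | insert i s hi ih => rw [Finset.sum_insert hi, Finset.prod_insert hi, rootChar_add, ih]

theorem mem_fixedSpace_iff (u : GenPerm d n) (v : Fin n → ℂ) :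
    v ∈ Module.End.eigenspace (Matrix.toLin' u.toMatrix) 1 ↔
      ∀ j, v (u.perm j) = rootChar d (u.weight j) * v j := by
  rw [Module.End.mem_eigenspace_iff, one_smul, Matrix.toLin'_apply, funext_iff]
  have h : ∀ j, (u.toMatrix.mulVec v) (u.perm j) = rootChar d (u.weight j) * v j := fun j => by
    simp only [Matrix.mulVec, dotProduct, GenPerm.toMatrix, Matrix.of_apply]
    rw [Finset.sum_eq_single j]
    · simp [rootChar]
    · intro i _ hij
      rw [if_neg (fun h => hij (u.perm.injective h).symm), zero_mul]
    · simp
  constructor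
  · intro H j
    rw [← h, H]
  · intro H i
    obtain ⟨j, rfl⟩ := u.perm.surjective i
    rw [h, H]

/-- A fixed vector nonzero at `j` is nonzero on the whole cycle. Multiplying the fixed vector
equations around the cycle gives `ω` to the cycle weight equal to `1`. -/
theorem cycleWeight_eq_zero_of_fixed [NeZero d] (u : GenPerm d n) {v : Fin n → ℂ}
    (hv : ∀ j, v (u.perm j) = rootChar d (u.weight j) * v j) {j : Fin n} (hj : v j ≠ 0) :
    cycleWeight u.perm u.weight (CycleSet.mk u.perm j) = 0 := by
  have hinv : ∀ i, (v (u.perm i) = 0) = (v i = 0) := fun i => by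
    rw [hv, mul_eq_zero, or_iff_right (rootChar_ne_zero _)]
  set S : Finset (Fin n) :=
    Finset.univ.filter (fun i => CycleSet.mk u.perm i = CycleSet.mk u.perm j) with hS
  have hne : ∏ i ∈ S, v i ≠ 0 := Finset.prod_ne_zero_iff.2 fun i hi h0 =>
    hj ((CycleSet.eq_of_invariant (f := fun i => v i = 0) hinv (Finset.mem_filter.1 hi).2) ▸ h0)
  have hshift : ∏ i ∈ S, v (u.perm i) = ∏ i ∈ S, v i := by
    rw [hS, Finset.prod_filter, Finset.prod_filter, ← Equiv.prod_comp u.perm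
      (fun i => if CycleSet.mk u.perm i = CycleSet.mk u.perm j then v i else 1)]
    simp only [CycleSet.mk_apply]
  apply rootChar_eq_one
  rw [cycleWeight_apply, rootChar_sum]
  refine mul_right_cancel₀ hne ?_
  rw [← Finset.prod_mul_distrib, one_mul, ← hshift]
  exact Finset.prod_congr rfl fun i _ => (hv i).symm

/-- The fixed space dimension is the number of cycles of weight zero. -/
theorem fixDim_eq_card [NeZero d] (u : GenPerm d n) :
    u.fixDim = Nat.card {C : CycleSet u.perm // cycleWeight u.perm u.weight C = 0} := by
  classical
  -- The weights are cut off outside the cycles of weight zero so that a potential exists. Then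
  -- `rootChar d (φ j)` gives the coordinates of a fixed vector on each such cycle, which is unique
  -- up to scale.
  obtain ⟨φ, hφ⟩ := exists_potential u.perm (A := ZMod d)
    (a := fun j => if cycleWeight u.perm u.weight (CycleSet.mk u.perm j) = 0
      then u.weight j else 0) (by
    ext C
    rw [cycleWeight_apply]
    have h : ∀ j ∈ Finset.univ.filter (fun j => CycleSet.mk u.perm j = C),
        (if cycleWeight u.perm u.weight (CycleSet.mk u.perm j) = 0 then u.weight j else 0) =
        if cycleWeight u.perm u.weight C = 0 then u.weight j else 0 := fun j hj => by
      rw [(Finset.mem_filter.1 hj).2]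
    rw [Finset.sum_congr rfl h]
    split_ifs with hC
    · exact hC
    · simp)
  let Ψ : ({C : CycleSet u.perm // cycleWeight u.perm u.weight C = 0} → ℂ) →ₗ[ℂ] (Fin n → ℂ) :=
    { toFun := fun c j => if h : cycleWeight u.perm u.weight (CycleSet.mk u.perm j) = 0
        then rootChar d (φ j) * c ⟨_, h⟩ else 0
      map_add' := fun c e => by
        ext j
        simp only [Pi.add_apply]
        split_ifs <;> ring
      map_smul' := fun r c => by
        ext j
        simp only [Pi.smul_apply, smul_eq_mul, RingHom.id_apply]
        split_ifs <;> ring }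
  have hΨ : ∀ c j, Ψ c j = if h : cycleWeight u.perm u.weight (CycleSet.mk u.perm j) = 0
        then rootChar d (φ j) * c ⟨_, h⟩ else 0 := fun c j => rfl
  have hinj : Function.Injective Ψ := fun c e h => by
    ext ⟨C, hC⟩
    obtain ⟨j, rfl⟩ := CycleSet.mk_surjective _ C
    have := congrFun h j
    rw [hΨ, hΨ, dif_pos hC, dif_pos hC] at this
    exact mul_left_cancel₀ (rootChar_ne_zero _) this
  have hrange : Module.End.eigenspace (Matrix.toLin' u.toMatrix) 1 = LinearMap.range Ψ := by
    ext v
    rw [mem_fixedSpace_iff, LinearMap.mem_range]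
    constructor
    · intro hv
      have hinv : ∀ j, (rootChar d (φ (u.perm j)))⁻¹ * v (u.perm j) =
          (rootChar d (φ j))⁻¹ * v j := fun j => by
        by_cases hj : v j = 0
        · rw [hv, hj, mul_zero, mul_zero, mul_zero]
        · have h0 := cycleWeight_eq_zero_of_fixed u hv hj
          rw [hφ, if_pos h0, rootChar_add, hv]
          have := rootChar_ne_zero (φ j)
          have := rootChar_ne_zero (u.weight j)
          field_simp
      refine ⟨fun C => CycleSet.lift (fun j => (rootChar d (φ j))⁻¹ * v j) hinv C, ?_⟩
      ext j
      rw [hΨ]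
      split_ifs with h
      · rw [CycleSet.lift_mk, mul_inv_cancel_left₀ (rootChar_ne_zero _)]
      · by_contra hj
        exact h (cycleWeight_eq_zero_of_fixed u hv (Ne.symm hj))
    · rintro ⟨c, rfl⟩ j
      rw [hΨ, hΨ]
      simp only [CycleSet.mk_apply]
      split_ifs with h
      · rw [hφ, if_pos h, rootChar_add]
        ring
      · rw [mul_zero]
  rw [GenPerm.fixDim, hrange, LinearMap.finrank_range_of_inj hinj,
    Module.finrank_fintype_fun_eq_card, Nat.card_eq_fintype_card]

theorem pow_fixDim [NeZero d] (u : GenPerm d n) (x : ℚ) : x ^ u.fixDim =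
    ∏ C : CycleSet u.perm, if cycleWeight u.perm u.weight C = 0 then x else 1 := by
  classical
  rw [fixDim_eq_card, Nat.card_eq_fintype_card, Fintype.card_subtype, Finset.prod_ite]
  simp

end FixedSpace

/-! ### Tuples in `ℤ/d` with prescribed sum, by number of zeros. -/

section ZeroSum

/-- An `m`-fold convolution power of `1 + (x - 1) δ₀` on `ℤ/d`: the trivial character has eigenvalue
`x + d - 1`, every other one `x - 1`. The induction convolves once more, using that the total mass
is `(x + d - 1) ^ m`. -/
theorem sum_prod_zero_weight (d : ℕ) [NeZero d] (x : ℚ) (m : ℕ) (t : ZMod d) :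
    ∑ s : Fin m → ZMod d, (if ∑ i, s i = t then ∏ i, (if s i = 0 then x else 1) else 0) =
      ((x + d - 1) ^ m + (if t = 0 then (d : ℚ) - 1 else -1) * (x - 1) ^ m) / d := by
  have hd : (d : ℚ) ≠ 0 := Nat.cast_ne_zero.2 (NeZero.ne d)
  induction m generalizing t with
  | zero =>
    by_cases ht : t = 0
    · simp [ht, hd]
    · simp [ht, Ne.symm ht]
  | succ m ih =>
    rw [← (Fin.consEquiv fun _ : Fin (m + 1) => ZMod d).sum_comp, Fintype.sum_prod_type]
    obtain ⟨G, hG⟩ : ∃ G : ZMod d → ℚ, ∀ r, G r =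
        ((x + d - 1) ^ m + (if r = t then (d : ℚ) - 1 else -1) * (x - 1) ^ m) / d :=
      ⟨_, fun r => rfl⟩
    have h : ∀ r : ZMod d, ∑ s : Fin m → ZMod d,
        (if ∑ i, (Fin.consEquiv fun _ => ZMod d) (r, s) i = t
        then ∏ i, (if (Fin.consEquiv fun _ => ZMod d) (r, s) i = 0 then x else 1) else 0) =
        (1 + if r = 0 then x - 1 else 0) * G r := by
      intro r
      have h2 := ih (t - r)
      simp only [sub_eq_zero, eq_comm (a := t)] at h2
      rw [hG, ← h2, Finset.mul_sum]
      refine Finset.sum_congr rfl fun s _ => ?_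
      simp only [Fin.consEquiv_apply, Fin.sum_univ_succ, Fin.prod_univ_succ, Fin.cons_zero,
        Fin.cons_succ]
      have hiff : r + ∑ i, s i = t ↔ ∑ i, s i = t - r := by
        rw [eq_sub_iff_add_eq, add_comm]
      by_cases hr : r = 0 <;> by_cases hs : ∑ i, s i = t - r <;> simp [hiff, hs, hr]
    simp only [h, add_mul, one_mul, ite_mul, zero_mul, Finset.sum_add_distrib,
      Finset.sum_ite_eq', Finset.mem_univ, if_true]
    have h3 : ∑ r : ZMod d, G r = (x + d - 1) ^ m := by
      have h4 : ∑ r : ZMod d, (if r = t then (d : ℚ) - 1 else -1) = 0 := by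
        rw [Finset.sum_congr rfl (g := fun r : ZMod d => (if r = t then (d : ℚ) else 0) + -1)
          (fun r _ => by split_ifs <;> ring), Finset.sum_add_distrib]
        simp [ZMod.card]
      simp only [hG]
      rw [← Finset.sum_div, Finset.sum_add_distrib, ← Finset.sum_mul, h4]
      simp [ZMod.card, hd]
    rw [h3, hG]
    simp only [eq_comm (a := (0 : ZMod d))]
    split_ifs
    · field_simp
      ring
    · field_simp
      ring

theorem sum_prod_zero_weight_of_fintype (d : ℕ) [NeZero d] (x : ℚ) (ι : Type*) [Fintype ι]
    [DecidableEq ι] :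
    ∑ s : ι → ZMod d, (if ∑ i, s i = 0 then ∏ i, (if s i = 0 then x else 1) else 0) =
      ((x + d - 1) ^ Nat.card ι + ((d : ℚ) - 1) * (x - 1) ^ Nat.card ι) / d := by
  have h := sum_prod_zero_weight d x (Fintype.card ι) 0
  rw [if_pos rfl] at h
  rw [Nat.card_eq_fintype_card, ← h]
  refine Fintype.sum_equiv ((Fintype.equivFin ι).arrowCongr (Equiv.refl _)) _ _ fun s => ?_
  simp only [arrowCongr_apply, coe_refl, Function.comp_apply, id_eq]
  rw [Equiv.sum_comp (Fintype.equivFin ι).symm s,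
    Equiv.prod_comp (Fintype.equivFin ι).symm (fun i => if s i = 0 then x else 1)]

end ZeroSum

/-! ### Counting the lifts of a factorization. -/

theorem AddMonoidHom.card_range_mul_sum {A B : Type*} [AddCommGroup A] [AddCommGroup B] [Fintype A]
    [Fintype B] (f : A →+ B) [DecidablePred (· ∈ f.range)] (g : B → ℚ) :
    (Nat.card f.range : ℚ) * ∑ a, g (f a) =
      (Nat.card A : ℚ) * ∑ b, (if b ∈ f.range then g b else 0) := by
  classical
  have hfib : ∀ b ∈ f.range, (Finset.univ.filter (fun a => f a = b)).card = Nat.card f.ker := by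
    intro b hb
    rw [AddMonoidHom.card_fiber_eq_of_mem_range f (x := b) (y := 0) hb ⟨0, map_zero f⟩,
      Nat.card_eq_fintype_card, ← Fintype.card_subtype]
    exact Fintype.card_congr (Equiv.subtypeEquivRight fun a => by simp [AddMonoidHom.mem_ker])
  have hsum : ∑ a, g (f a) =
      (Nat.card f.ker : ℚ) * ∑ b, (if b ∈ f.range then g b else 0) := by
    rw [← Finset.sum_fiberwise Finset.univ f, Finset.mul_sum]
    refine Finset.sum_congr rfl fun b _ => ?_
    rw [Finset.sum_congr rfl (g := fun _ => g b)
      (fun a ha => by rw [(Finset.mem_filter.1 ha).2]), Finset.sum_const, nsmul_eq_mul]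
    split_ifs with hb
    · rw [hfib b hb]
    · rw [Finset.filter_eq_empty_iff.2 (fun a _ ha => hb ⟨a, ha⟩)]
      simp
  have hcard : Nat.card A = Nat.card f.range * Nat.card f.ker := by
    rw [AddSubgroup.card_eq_card_quotient_mul_card_addSubgroup f.ker,
      Nat.card_congr (QuotientAddGroup.quotientKerEquivRange f).toEquiv]
  rw [hsum, hcard]
  push_cast
  ring

section Lifts

variable {d n : ℕ}

/-- The projection of `G(d,1,n)` onto the symmetric group. -/
def GenPerm.permHom (d n : ℕ) : GenPerm d n →* Perm (Fin n) where
  toFun u := u.perm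
  map_one' := rfl
  map_mul' _ _ := rfl

theorem GenPerm.prod_ofFn_perm {k : ℕ} (u : Fin k → GenPerm d n) :
    (List.ofFn u).prod.perm = (List.ofFn fun i => (u i).perm).prod := by
  have h := map_list_prod (GenPerm.permHom d n) (List.ofFn u)
  rw [List.map_ofFn] at h
  exact h

theorem apply_eq_of_mem_closure {X β : Type*} {k : ℕ} {π : Fin k → Perm X} {f : X → β}
    (hf : ∀ i m, f (π i m) = f m) {g : Perm X} (hg : g ∈ Subgroup.closure (Set.range π)) (m : X) :
    f (g m) = f m := by
  induction hg using Subgroup.closure_induction generalizing m with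
  | mem g hg => obtain ⟨i, rfl⟩ := hg; exact hf i m
  | one => simp
  | mul g h _ _ ihg ihh => rw [Perm.mul_apply, ihg, ihh]
  | inv g _ ihg => rw [← ihg (g⁻¹ m)]; simp

/-- The permutation `q i` is the product of the factors to the right of the `i`-th. The second
property untwists invariance: from the last factor backwards, `f` is invariant under the factors
already treated, hence under their product, which can be dropped from the hypothesis on the next
one. -/
theorem GenPerm.exists_prod_weight {k : ℕ} (π : Fin k → Perm (Fin n)) :
    ∃ q : Fin k → Perm (Fin n),
      (∀ (a : Fin k → Fin n → ZMod d) (j : Fin n),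
        (List.ofFn fun i => (⟨π i, a i⟩ : GenPerm d n)).prod.weight j = ∑ i, a i (q i j)) ∧
      ∀ {β : Type} (f : Fin n → β),
        (∀ i m, f ((q i)⁻¹ (π i m)) = f ((q i)⁻¹ m)) → ∀ i m, f (π i m) = f m := by
  induction k with
  | zero => exact ⟨fun i => i.elim0, fun a j => by simp, fun f _ i => i.elim0⟩
  | succ k ih =>
    obtain ⟨q, hq, hf⟩ := ih (fun i => π i.succ)
    refine ⟨Fin.cons (List.ofFn fun i : Fin k => π i.succ).prod q, fun a j => ?_,
      fun f h => ?_⟩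
    · rw [List.ofFn_succ, List.prod_cons, GenPerm.mul_weight, hq (fun i => a i.succ),
        Fin.sum_univ_succ, GenPerm.prod_ofFn_perm]
      simp
    · have htail : ∀ (i : Fin k) m, f (π i.succ m) = f m :=
        hf f fun i m => by simpa using h i.succ m
      have hprod : ∀ m, f ((List.ofFn fun i : Fin k => π i.succ).prod m) = f m :=
        apply_eq_of_mem_closure htail (prod_ofFn_mem_closure _)
      have hinv : ∀ m, f ((List.ofFn fun i : Fin k => π i.succ).prod⁻¹ m) = f m := fun m => by
        rw [← hprod]; simp
      intro i m
      refine Fin.cases ?_ (fun i => htail i m) i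
      have h0 := h 0 m
      rw [Fin.cons_zero, hinv, hinv] at h0
      exact h0

theorem eq_of_invariant_of_isPretransitive {X β : Type*} {k : ℕ} {π : Fin k → Perm X}
    (hπ : MulAction.IsPretransitive (Subgroup.closure (Set.range π)) X) {f : X → β}
    (hf : ∀ i m, f (π i m) = f m) (x y : X) : f x = f y := by
  obtain ⟨g, rfl⟩ := hπ.exists_smul_eq x y
  exact (apply_eq_of_mem_closure hf g.2 x).symm

/-- The weights of the product and of the cycles of a tuple of elements of `G(d,1,n)`, as an
additive function of the weights of the factors. -/
noncomputable def liftHom (d : ℕ) {k : ℕ} (π q : Fin k → Perm (Fin n)) :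
    (Fin k → Fin n → ZMod d) →+ (Fin n → ZMod d) × (∀ i, CycleSet (π i) → ZMod d) where
  toFun a := (fun j => ∑ i, a i (q i j), fun i => cycleWeight (π i) (a i))
  map_zero' := by ext <;> simp
  map_add' a b := by ext <;> simp [Finset.sum_add_distrib]

/-- The difference of the total weights. -/
noncomputable def weightDefect (d : ℕ) {k : ℕ} (π : Fin k → Perm (Fin n)) :
    (Fin n → ZMod d) × (∀ i, CycleSet (π i) → ZMod d) →+ ZMod d where
  toFun y := ∑ j, y.1 j - ∑ i, ∑ C, y.2 i C
  map_zero' := by simp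
  map_add' y z := by simp [Finset.sum_add_distrib]; ring

/-- The cokernel is generated by the classes `U j` of product weights and `V i C` of cycle weights.
Each single weight of a factor gives a relation `U = -V`; transitivity then forces all `U j` to
coincide, so the class of a pair is governed by the difference of total weights alone. -/
theorem range_liftHom [NeZero n] {k : ℕ} {π q : Fin k → Perm (Fin n)}
    (hπ : MulAction.IsPretransitive (Subgroup.closure (Set.range π)) (Fin n))
    (hq : ∀ {β : Type} (f : Fin n → β),
        (∀ i m, f ((q i)⁻¹ (π i m)) = f ((q i)⁻¹ m)) → ∀ i m, f (π i m) = f m) :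
    (liftHom d π q).range = (weightDefect d π).ker := by
  refine le_antisymm ?_ ?_
  · rintro _ ⟨a, rfl⟩
    rw [AddMonoidHom.mem_ker]
    change ∑ j, ∑ i, a i (q i j) - ∑ i, ∑ C, cycleWeight (π i) (a i) C = 0
    rw [Finset.sum_comm, sub_eq_zero]
    refine Finset.sum_congr rfl fun i _ => ?_
    rw [sum_cycleWeight, Equiv.sum_comp (q i) (a i)]
  · rintro ⟨w, s⟩ hy
    have hy' : ∑ j, w j - ∑ i, ∑ C, s i C = 0 := hy
    let Q := QuotientAddGroup.mk' (liftHom d π q).range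
    let U : Fin n → ZMod d →+ _ := fun j =>
      Q.comp ((AddMonoidHom.inl _ _).comp (AddMonoidHom.single (fun _ : Fin n => ZMod d) j))
    let V : ∀ i, CycleSet (π i) → ZMod d →+ _ := fun i C =>
      Q.comp ((AddMonoidHom.inr _ _).comp ((AddMonoidHom.single
        (fun i => CycleSet (π i) → ZMod d) i).comp
          (AddMonoidHom.single (fun _ : CycleSet (π i) => ZMod d) C)))
    -- The image of the weight `t` at position `m` of factor `i` has just these two coordinates.
    have hrel : ∀ i m, U ((q i)⁻¹ m) = - V i (CycleSet.mk (π i) m) := fun i m => by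
      ext t
      rw [AddMonoidHom.neg_apply, eq_neg_iff_add_eq_zero]
      change Q _ + Q _ = 0
      rw [← map_add]
      refine (QuotientAddGroup.eq_zero_iff _).2 ⟨Pi.single i (Pi.single m t), ?_⟩
      refine Prod.ext ?_ ?_
      · ext j
        have : (fun i' => (Pi.single i (Pi.single m t) : Fin k → Fin n → ZMod d) i' (q i' j)) =
            Pi.single i ((Pi.single m t : Fin n → ZMod d) (q i j)) := by
          ext i'
          by_cases h : i' = i
          · subst h; simp
          · simp [h]
        change ∑ i', (Pi.single i (Pi.single m t) : Fin k → Fin n → ZMod d) i' (q i' j) = _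
        rw [Finset.sum_congr rfl fun i' _ => congrFun this i', Finset.sum_pi_single']
        simp [Pi.single_apply, Equiv.eq_symm_apply]
      · ext i' C
        change cycleWeight (π i') ((Pi.single i (Pi.single m t) : Fin k → Fin n → ZMod d) i') C = _
        by_cases h : i' = i
        · subst h
          simp [cycleWeight_single]
        · simp [h]
    have hU : ∀ j j', U j = U j' :=
      eq_of_invariant_of_isPretransitive hπ (hq U fun i m => by
        rw [hrel, hrel, CycleSet.mk_apply])
    have hV : ∀ i C, V i C = - U 0 := fun i C => by
      obtain ⟨m, rfl⟩ := CycleSet.mk_surjective _ C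
      ext t
      rw [hU 0 ((q i)⁻¹ m), hrel]
      simp
    have hdecomp : (w, s) = ∑ j, (AddMonoidHom.inl (Fin n → ZMod d)
          (∀ i, CycleSet (π i) → ZMod d)) (Pi.single j (w j)) +
        ∑ i, ∑ C, (AddMonoidHom.inr (Fin n → ZMod d) (∀ i, CycleSet (π i) → ZMod d))
          (Pi.single i (Pi.single C (s i C))) := by
      rw [← map_sum, Finset.univ_sum_single]
      have : ∀ i, ∑ C, (AddMonoidHom.inr (Fin n → ZMod d) (∀ i, CycleSet (π i) → ZMod d))
          (Pi.single i (Pi.single C (s i C))) = (AddMonoidHom.inr (Fin n → ZMod d)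
            (∀ i, CycleSet (π i) → ZMod d)) (Pi.single i (s i)) := fun i => by
        rw [← map_sum]
        congr 1
        change ∑ C, AddMonoidHom.single (fun i => CycleSet (π i) → ZMod d) i _ = _
        rw [← map_sum, Finset.univ_sum_single]
        rfl
      simp only [this]
      rw [← map_sum, Finset.univ_sum_single]
      simp
    have hQ : Q (w, s) = 0 := by
      rw [hdecomp, map_add, map_sum, map_sum]
      simp only [map_sum]
      change ∑ j, U j (w j) + ∑ i, ∑ C, V i C (s i C) = 0
      simp only [hV, fun j => hU j 0, AddMonoidHom.neg_apply, Finset.sum_neg_distrib, ← map_sum]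
      rw [← sub_eq_add_neg, ← map_sub, hy', map_zero]
    exact (QuotientAddGroup.eq_zero_iff _).1 hQ

theorem card_range_liftHom [NeZero d] [NeZero n] {k : ℕ} {π q : Fin k → Perm (Fin n)}
    (hπ : MulAction.IsPretransitive (Subgroup.closure (Set.range π)) (Fin n))
    (hq : ∀ {β : Type} (f : Fin n → β),
        (∀ i m, f ((q i)⁻¹ (π i m)) = f ((q i)⁻¹ m)) → ∀ i m, f (π i m) = f m) :
    d * Nat.card (liftHom d π q).range = d ^ n * ∏ i, d ^ cycleCount (π i) := by
  have hsurj : Function.Surjective (weightDefect d π) := fun t =>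
    ⟨(Pi.single 0 t, 0), by simp [weightDefect]⟩
  rw [range_liftHom hπ hq]
  have h := AddSubgroup.card_eq_card_quotient_mul_card_addSubgroup (weightDefect d π).ker
  rw [Nat.card_congr (QuotientAddGroup.quotientKerEquivOfSurjective _ hsurj).toEquiv] at h
  rw [Nat.card_zmod] at h
  rw [← h, Nat.card_prod, Nat.card_pi]
  simp [cycleCount]

/-- Enumeration of the lifts to `G(d,d,n)` of a transitive factorization in the symmetric group. -/
theorem sum_lifts [NeZero d] [NeZero n] {k : ℕ} {π : Fin k → Perm (Fin n)}
    (hπ : MulAction.IsPretransitive (Subgroup.closure (Set.range π)) (Fin n))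
    {w : Fin n → ZMod d} (hw : ∑ j, w j = 0) (x : Fin k → ℚ) :
    ((d : ℚ) ^ n * ∏ i, (d : ℚ) ^ cycleCount (π i)) *
      ∑ a : Fin k → Fin n → ZMod d,
        (if (List.ofFn fun i => (⟨π i, a i⟩ : GenPerm d n)).prod.weight = w ∧
            ∀ i, ∑ j, a i j = 0 then
          ∏ i, x i ^ (⟨π i, a i⟩ : GenPerm d n).fixDim else 0) =
      d ^ (k * n + 1) * ∏ i, (((x i + d - 1) ^ cycleCount (π i) +
        ((d : ℚ) - 1) * (x i - 1) ^ cycleCount (π i)) / d) := by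
  classical
  obtain ⟨q, hqw, hq⟩ := GenPerm.exists_prod_weight (d := d) π
  have hcard := card_range_liftHom (d := d) hπ hq
  let g : (Fin n → ZMod d) × (∀ i, CycleSet (π i) → ZMod d) → ℚ := fun y =>
    if y.1 = w then ∏ i, (if ∑ C, y.2 i C = 0 then
      ∏ C, (if y.2 i C = 0 then x i else 1) else 0) else 0
  have hg : ∀ a : Fin k → Fin n → ZMod d,
      (if (List.ofFn fun i => (⟨π i, a i⟩ : GenPerm d n)).prod.weight = w ∧
            ∀ i, ∑ j, a i j = 0 then
          ∏ i, x i ^ (⟨π i, a i⟩ : GenPerm d n).fixDim else 0) = g (liftHom d π q a) := by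
    intro a
    have h1 : (List.ofFn fun i => (⟨π i, a i⟩ : GenPerm d n)).prod.weight =
        (liftHom d π q a).1 := funext fun j => hqw a j
    have h2 : ∀ i, ∑ C, (liftHom d π q a).2 i C = ∑ j, a i j := fun i => sum_cycleWeight _ _
    have h3 : ∀ i, x i ^ (⟨π i, a i⟩ : GenPerm d n).fixDim =
      ∏ C, (if (liftHom d π q a).2 i C = 0 then x i else 1) := fun i => pow_fixDim _ _
    simp only [g, h1, h2, h3, Finset.prod_ite_zero, Finset.mem_univ, true_imp_iff]
    rw [ite_and]
  -- Where `g` is nonzero, all total weights vanish, so the single relation defining the range holds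
  -- and the range condition can be dropped.
  have hsupp : ∀ y, y ∉ (liftHom d π q).range → 0 = g y := by
    intro y h
    by_contra hne
    apply h
    rw [range_liftHom hπ hq, AddMonoidHom.mem_ker]
    have hy1 : y.1 = w := by
      by_contra h1
      exact hne (by simp [g, h1])
    have hy2 : ∀ i, ∑ C, y.2 i C = 0 := fun i => by
      by_contra h2
      refine hne (Eq.symm ?_)
      simp only [g]
      rw [Finset.prod_eq_zero (Finset.mem_univ i) (if_neg h2), ite_self]
    change ∑ j, y.1 j - ∑ i, ∑ C, y.2 i C = 0
    simp [hy1, hy2, hw]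
  have hsum : (Nat.card (liftHom d π q).range : ℚ) * ∑ a, g (liftHom d π q a) =
      (Nat.card (Fin k → Fin n → ZMod d) : ℚ) * ∑ y, g y := by
    rw [AddMonoidHom.card_range_mul_sum]
    congr 1
    refine Finset.sum_congr rfl fun y _ => ?_
    split_ifs with h
    · rfl
    · exact hsupp y h
  have htotal : ∑ y, g y = ∏ i, (((x i + d - 1) ^ cycleCount (π i) +
        ((d : ℚ) - 1) * (x i - 1) ^ cycleCount (π i)) / d) := by
    rw [Fintype.sum_prod_type, Finset.sum_eq_single w]
    · simp only [g, if_true]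
      have h := Finset.prod_univ_sum
        (fun i : Fin k => (Finset.univ : Finset (CycleSet (π i) → ZMod d)))
        (fun i s => if ∑ C, s C = 0 then ∏ C, (if s C = 0 then x i else 1) else 0)
      rw [Fintype.piFinset_univ] at h
      rw [← h]
      exact Finset.prod_congr rfl fun i _ => sum_prod_zero_weight_of_fintype d (x i) _
    · intro v _ hv
      simp [g, hv]
    · simp
  have hcardA : (Nat.card (Fin k → Fin n → ZMod d) : ℚ) = d ^ (k * n) := by
    simp [← pow_mul, mul_comm]
  have hcard' : (d : ℚ) ^ n * ∏ i, (d : ℚ) ^ cycleCount (π i) =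
      d * Nat.card (liftHom d π q).range := by exact_mod_cast hcard.symm
  rw [hcard', mul_assoc, Finset.sum_congr rfl fun a _ => hg a, hsum, htotal, hcardA, pow_succ]
  ring

end Lifts

/-! ### Factorizations of Coxeter elements in `G(d,d,n)`. -/

section CoxeterFactorizations

variable {d n : ℕ}

theorem cycleRange_sameCycle {m : ℕ} (x y : Fin (m + 2)) (hx : x ≠ Fin.last (m + 1))
    (hy : y ≠ Fin.last (m + 1)) :
    (Fin.cycleRange (⟨m, by omega⟩ : Fin (m + 2))).SameCycle x y := by
  have hlt : ∀ z : Fin (m + 2), z ≠ Fin.last (m + 1) → (z : ℕ) ≤ m := fun z hz => by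
    have := z.isLt
    have : (z : ℕ) ≠ m + 1 := fun h => hz (Fin.ext h)
    omega
  rcases Nat.eq_zero_or_pos m with rfl | hm
  · have : x = y := Fin.ext (by have := hlt x hx; have := hlt y hy; omega)
    rw [this]
  · have hmove : ∀ z : Fin (m + 2), z ≠ Fin.last (m + 1) →
        Fin.cycleRange (⟨m, by omega⟩ : Fin (m + 2)) z ≠ z := fun z hz h => by
      rcases (hlt z hz).lt_or_eq with h1 | h1
      · rw [Fin.cycleRange_of_lt (Fin.lt_def.2 h1)] at h
        have := congrArg Fin.val h
        rw [Fin.val_add_one_of_lt (lt_of_le_of_ne (Fin.le_last z) hz)] at this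
        omega
      · rw [Fin.cycleRange_of_eq (Fin.ext h1)] at h
        rw [← h] at h1
        simp at h1
        omega
    exact (Fin.isCycle_cycleRange (by intro h; simp [Fin.ext_iff] at h; omega)).sameCycle
      (hmove x hx) (hmove y hy)

/-- All that is used about a Coxeter element. Conjugation moves the fixed letter but does not change
the weight `-a` there. -/
theorem IsCoxeterElement.exists_fixed_point {hn : 2 ≤ n} {c : Gddn d n}
    (hc : IsCoxeterElement d n hn c) : ∃ b : Fin n, (c : GenPerm d n).perm b = b ∧
      (∀ x y, x ≠ b → y ≠ b → (c : GenPerm d n).perm.SameCycle x y) ∧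
      IsUnit ((c : GenPerm d n).weight b) := by
  obtain ⟨a, ha⟩ := hc
  obtain ⟨g, rfl⟩ := isConj_iff.1 ha
  obtain ⟨m, rfl⟩ : ∃ m, n = m + 2 := ⟨n - 2, by omega⟩
  set c₀ : GenPerm d (m + 2) := (coxeterElement d (m + 2) hn a : GenPerm d (m + 2)) with hc₀
  set h : GenPerm d (m + 2) := (g : GenPerm d (m + 2)) with hh
  have hcoe : ((g * coxeterElement d (m + 2) hn a * g⁻¹ : Gddn d (m + 2)) : GenPerm d (m + 2)) =
    h * c₀ * h⁻¹ := rfl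
  have hperm : c₀.perm = Fin.cycleRange ⟨m, by omega⟩ := rfl
  have hlast : c₀.perm (Fin.last (m + 1)) = Fin.last (m + 1) := by
    rw [hperm, Fin.cycleRange_of_gt]
    exact Fin.lt_def.2 (by simp)
  have hweight : c₀.weight (Fin.last (m + 1)) = -a := by
    change (if ((Fin.last (m + 1) : Fin (m + 2)) : ℕ) = m + 2 - 2 then (a : ZMod d)
      else if ((Fin.last (m + 1) : Fin (m + 2)) : ℕ) = m + 2 - 1 then -a else 0) = -a
    simp
  rw [hcoe]
  refine ⟨h.perm (Fin.last (m + 1)), by simp [hlast], fun x y hx hy => ?_, ?_⟩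
  · rw [GenPerm.mul_perm, GenPerm.mul_perm, GenPerm.inv_perm, Perm.sameCycle_conj, hperm]
    refine cycleRange_sameCycle _ _ (fun hx' => hx ?_) (fun hy' => hy ?_)
    · rw [← hx']; simp
    · rw [← hy']; simp
  · simp [hlast, hweight]

theorem GenPerm.smul_eq (g : GenPerm d n) (y : Fin n × ZMod d) :
    g • y = (g.perm y.1, y.2 + g.weight y.1) := rfl

theorem GenPerm.pow_smul_fixed {c : GenPerm d n} {b : Fin n} (hb : c.perm b = b) (m : ℕ)
    (s : ZMod d) : c ^ m • (b, s) = (b, s + m * c.weight b) := by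
  induction m with
  | zero => simp
  | succ m ih =>
    rw [pow_succ', mul_smul, ih, GenPerm.smul_eq]
    simp only [hb, Nat.cast_succ]
    congr 1
    ring

/-- Transitivity on the vectors `ω ^ i • e_j` can be tested on the underlying permutations. -/
theorem isPretransitive_iff_perm [NeZero d] {c : Gddn d n} {b : Fin n}
    (hb : (c : GenPerm d n).perm b = b) (hw : IsUnit ((c : GenPerm d n).weight b)) {k : ℕ}
    {u : Fin k → Gddn d n} (hu : (List.ofFn u).prod = c) :
    MulAction.IsPretransitive (Subgroup.closure (Set.range u)) (Fin n × ZMod d) ↔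
      MulAction.IsPretransitive (Subgroup.closure (Set.range fun i => (u i : GenPerm d n).perm))
        (Fin n) := by
  let p : Gddn d n →* Perm (Fin n) := (GenPerm.permHom d n).comp (Gddn d n).subtype
  have hmap : (Subgroup.closure (Set.range u)).map p =
      Subgroup.closure (Set.range fun i => (u i : GenPerm d n).perm) := by
    rw [MonoidHom.map_closure, ← Set.range_comp]
    rfl
  constructor
  · intro h
    refine ⟨fun x y => ?_⟩
    obtain ⟨g, hg⟩ := h.exists_smul_eq (x, 0) (y, 0)
    refine ⟨⟨p g, hmap ▸ Subgroup.mem_map_of_mem p g.2⟩, ?_⟩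
    exact congrArg Prod.fst hg
  · intro h
    rw [MulAction.isPretransitive_iff_base (b, (0 : ZMod d))]
    rintro ⟨y, t⟩
    obtain ⟨g', hg'⟩ := h.exists_smul_eq b y
    have hmem : (g' : Perm (Fin n)) ∈ (Subgroup.closure (Set.range u)).map p := by
      rw [hmap]
      exact g'.2
    obtain ⟨g, hg, hgg⟩ := hmem
    have hgb : (g : GenPerm d n).perm b = y := by
      have : p g b = y := by rw [hgg]; exact hg'
      exact this
    have hcmem : c ∈ Subgroup.closure (Set.range u) := by
      rw [← hu]
      exact prod_ofFn_mem_closure u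
    obtain ⟨w, hw⟩ := hw
    -- Powers of `c` shift the second coordinate over `b` by multiples of the unit `w`; this
    -- exponent makes up exactly what `g` misses of `t`.
    let m := ((t - (g : GenPerm d n).weight b) * ((w⁻¹ : (ZMod d)ˣ) : ZMod d)).val
    refine ⟨⟨g * c ^ m, mul_mem hg (pow_mem hcmem m)⟩, ?_⟩
    change ((g : GenPerm d n) * (c : GenPerm d n) ^ m) • (b, (0 : ZMod d)) = (y, t)
    rw [mul_smul, GenPerm.pow_smul_fixed hb, GenPerm.smul_eq, ← hw]
    simp [m, hgb]

/-- An element of `G(d,1,n)` as a pair. -/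
def GenPerm.equivProd (d n : ℕ) : GenPerm d n ≃ Perm (Fin n) × (Fin n → ZMod d) where
  toFun u := (u.perm, u.weight)
  invFun y := ⟨y.1, y.2⟩
  left_inv _ := rfl
  right_inv _ := rfl

instance [NeZero d] : Fintype (GenPerm d n) := Fintype.ofEquiv _ (GenPerm.equivProd d n).symm

noncomputable instance [NeZero d] : Fintype (Gddn d n) := Fintype.ofFinite _

theorem card_Gddn [NeZero d] [NeZero n] : d * Nat.card (Gddn d n) = d ^ n * n.factorial := by
  let f : (Fin n → ZMod d) →+ ZMod d :=
    { toFun := fun a => ∑ j, a j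
      map_zero' := by simp
      map_add' := fun a b => by simp [Finset.sum_add_distrib] }
  have hsurj : Function.Surjective f := fun t => ⟨Pi.single 0 t, by simp [f]⟩
  have e : Gddn d n ≃ Perm (Fin n) × f.ker :=
    { toFun := fun u => (u.1.perm, ⟨u.1.weight, u.2⟩)
      invFun := fun y => ⟨⟨y.1, y.2.1⟩, y.2.2⟩
      left_inv := fun _ => rfl
      right_inv := fun _ => rfl }
  have h := AddSubgroup.card_eq_card_quotient_mul_card_addSubgroup f.ker
  rw [Nat.card_congr (QuotientAddGroup.quotientKerEquivOfSurjective _ hsurj).toEquiv,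
    Nat.card_zmod, Nat.card_fun, Nat.card_zmod, Nat.card_eq_fintype_card, Fintype.card_fin] at h
  rw [Nat.card_congr e, Nat.card_prod, Nat.card_eq_fintype_card (α := Perm (Fin n)),
    Fintype.card_perm, Fintype.card_fin, h]
  ring

theorem sum_Gddn_tuple [NeZero d] {k : ℕ}
    (f : (Fin k → Perm (Fin n)) → (Fin k → Fin n → ZMod d) → ℚ) :
    ∑ u : Fin k → Gddn d n, f (fun i => (u i : GenPerm d n).perm)
      (fun i => (u i : GenPerm d n).weight) =
      ∑ π : Fin k → Perm (Fin n), ∑ a : Fin k → Fin n → ZMod d,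
        if ∀ i, ∑ j, a i j = 0 then f π a else 0 := by
  rw [← Fintype.sum_prod_type', ← Finset.sum_filter]
  refine Finset.sum_bij (fun u _ => (fun i => (u i : GenPerm d n).perm,
    fun i => (u i : GenPerm d n).weight)) ?_ ?_ ?_ ?_
  · intro u _
    simp only [Finset.mem_filter, Finset.mem_univ, true_and]
    exact fun i => (u i).2
  · intro u _ v _ h
    rw [Prod.mk.injEq] at h
    ext i : 2
    exact GenPerm.ext (congrFun h.1 i) (congrFun h.2 i)
  · rintro ⟨π, a⟩ h
    exact ⟨fun i => ⟨⟨π i, a i⟩, (Finset.mem_filter.1 h).2 i⟩, Finset.mem_univ _, rfl⟩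
  · intro u _
    rfl

/-- Enumeration of the transitive factorizations of a Coxeter element by fixed space dimensions. -/
theorem sum_transitive_factorizations_Gddn (hn : 2 ≤ n) (c : Gddn d n)
    (hc : IsCoxeterElement d n hn c) [NeZero d] {k : ℕ} (x : Fin k → ℚ) :
    (n.factorial : ℚ) * (d : ℚ) ^ n * d ^ k * (∑ u : Fin k → Gddn d n,
      open Classical in if (List.ofFn u).prod = c ∧
        MulAction.IsPretransitive (Subgroup.closure (Set.range u)) (Fin n × ZMod d) then
        ∏ i, x i ^ (u i : GenPerm d n).fixDim else 0) =
      d ^ (k * n + 1) * ∑ t ∈ Finset.range (n + 1), (-1) ^ t * (n.choose t : ℚ) *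
        ∏ i, ((x i + d - 1) / d * (∏ j ∈ Finset.range (n - 1), ((x i + d - 1) / d - t + 1 + j)) +
          (d - 1) * ((x i - 1) / d *
            ∏ j ∈ Finset.range (n - 1), ((x i - 1) / d - t + 1 + j))) := by
  classical
  have hd0 : (d : ℚ) ≠ 0 := Nat.cast_ne_zero.2 (NeZero.ne d)
  have hn0 : NeZero n := ⟨by omega⟩
  obtain ⟨b, hb, hς, hw⟩ := hc.exists_fixed_point
  have hu : ∀ u : Fin k → Gddn d n, (List.ofFn u).prod = c ↔
      (List.ofFn fun i => (u i : GenPerm d n).perm).prod = (c : GenPerm d n).perm ∧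
      (List.ofFn fun i => (⟨(u i : GenPerm d n).perm, (u i : GenPerm d n).weight⟩ :
        GenPerm d n)).prod.weight = (c : GenPerm d n).weight := fun u => by
    have h := map_list_prod (Gddn d n).subtype (List.ofFn u)
    rw [List.map_ofFn] at h
    have h' : (((List.ofFn u).prod : Gddn d n) : GenPerm d n) =
      (List.ofFn fun i => (u i : GenPerm d n)).prod := h
    rw [Subtype.ext_iff, h', GenPerm.ext_iff, GenPerm.prod_ofFn_perm]
  set T : (Fin k → Perm (Fin n)) → Prop := fun π => (List.ofFn π).prod = (c : GenPerm d n).perm ∧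
    MulAction.IsPretransitive (Subgroup.closure (Set.range π)) (Fin n) with hT
  have hS : (∑ u : Fin k → Gddn d n, if (List.ofFn u).prod = c ∧
        MulAction.IsPretransitive (Subgroup.closure (Set.range u)) (Fin n × ZMod d) then
        ∏ i, x i ^ (u i : GenPerm d n).fixDim else 0) =
      ∑ π : Fin k → Perm (Fin n), if T π then
        ∑ a : Fin k → Fin n → ZMod d,
          (if (List.ofFn fun i => (⟨π i, a i⟩ : GenPerm d n)).prod.weight =
              (c : GenPerm d n).weight ∧ ∀ i, ∑ j, a i j = 0 then
            ∏ i, x i ^ (⟨π i, a i⟩ : GenPerm d n).fixDim else 0) else 0 := by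
    rw [Finset.sum_congr rfl fun u _ => ?_, sum_Gddn_tuple (fun π a => if T π ∧
      (List.ofFn fun i => (⟨π i, a i⟩ : GenPerm d n)).prod.weight = (c : GenPerm d n).weight then
        ∏ i, x i ^ (⟨π i, a i⟩ : GenPerm d n).fixDim else 0)]
    · refine Finset.sum_congr rfl fun π _ => ?_
      by_cases hπ : T π
      · simp only [hπ, true_and, if_true]
        refine Finset.sum_congr rfl fun a _ => ?_
        rw [← ite_and]
        exact if_congr and_comm rfl rfl
      · simp [hπ]
    · refine if_congr ?_ rfl rfl
      constructor
      · rintro ⟨h1, h2⟩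
        exact ⟨⟨((hu u).1 h1).1, (isPretransitive_iff_perm hb hw h1).1 h2⟩, ((hu u).1 h1).2⟩
      · rintro ⟨⟨h1, h2⟩, h3⟩
        have h4 := (hu u).2 ⟨h1, h3⟩
        exact ⟨h4, (isPretransitive_iff_perm hb hw h4).2 h2⟩
  -- the two values at which the cycle enumerator of the symmetric group is taken
  let y : Fin k → Bool → ℚ := fun i ε => if ε then (x i + d - 1) / d else (x i - 1) / d
  let e : Bool → ℚ := fun ε => if ε then 1 else d - 1
  have hlift : ∀ π : Fin k → Perm (Fin n), T π → (d : ℚ) ^ n * d ^ k *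
      (∑ a : Fin k → Fin n → ZMod d,
          (if (List.ofFn fun i => (⟨π i, a i⟩ : GenPerm d n)).prod.weight =
              (c : GenPerm d n).weight ∧ ∀ i, ∑ j, a i j = 0 then
            ∏ i, x i ^ (⟨π i, a i⟩ : GenPerm d n).fixDim else 0)) =
      d ^ (k * n + 1) * ∑ ε : Fin k → Bool,
        ((∏ i, e (ε i)) * ∏ i, y i (ε i) ^ cycleCount (π i)) := by
    intro π hπ
    have h := sum_lifts (d := d) hπ.2 (w := (c : GenPerm d n).weight) c.2 x
    -- Each factor is a sum of two `m`-th powers, `m` its number of cycles; expanding over the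
    -- choices `ε` leaves pure monomials, to which the symmetric group formula applies.
    have h1 : ∑ ε : Fin k → Bool, ((∏ i, e (ε i)) * ∏ i, y i (ε i) ^ cycleCount (π i)) =
        ∏ i, (((x i + d - 1) / d) ^ cycleCount (π i) +
          (d - 1) * ((x i - 1) / d) ^ cycleCount (π i)) := by
      have h2 := Finset.prod_univ_sum (fun _ : Fin k => (Finset.univ : Finset Bool))
        (fun i ε => e ε * y i ε ^ cycleCount (π i))
      rw [Fintype.piFinset_univ] at h2
      simp only [← Finset.prod_mul_distrib]
      rw [← h2]
      simp [e, y]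
    have h3 : ∏ i, (((x i + d - 1) / d) ^ cycleCount (π i) +
          (d - 1) * ((x i - 1) / d) ^ cycleCount (π i)) =
        d ^ k * (∏ i, (d : ℚ) ^ cycleCount (π i))⁻¹ * ∏ i, (((x i + d - 1) ^ cycleCount (π i) +
        ((d : ℚ) - 1) * (x i - 1) ^ cycleCount (π i)) / d) := by
      rw [← Finset.prod_inv_distrib, show (d : ℚ) ^ k = ∏ _i : Fin k, (d : ℚ) by simp,
        ← Finset.prod_mul_distrib, ← Finset.prod_mul_distrib]
      refine Finset.prod_congr rfl fun i _ => ?_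
      rw [div_pow, div_pow]
      field_simp
    have hne : ∏ i, (d : ℚ) ^ cycleCount (π i) ≠ 0 :=
      Finset.prod_ne_zero_iff.2 fun i _ => pow_ne_zero _ hd0
    rw [h1, h3]
    refine mul_left_cancel₀ hne ?_
    rw [show ∀ A B C D : ℚ, A * (B * (C * A⁻¹ * D)) = (A * A⁻¹) * (C * (B * D)) by intros; ring,
      mul_inv_cancel₀ hne, ← h]
    ring
  have hF : ∀ ε : Fin k → Bool, (n.factorial : ℚ) * (∑ π : Fin k → Perm (Fin n),
        if T π then ∏ i, y i (ε i) ^ cycleCount (π i) else 0) =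
      ∑ t ∈ Finset.range (n + 1), (-1) ^ t * (n.choose t : ℚ) *
        ∏ i, (y i (ε i) * ∏ j ∈ Finset.range (n - 1), (y i (ε i) - t + 1 + j)) := fun ε => by
    rw [← sum_transitive_factorizations hn hb hς]
  rw [hS, mul_assoc, mul_assoc, ← mul_assoc (_ ^ n), Finset.mul_sum]
  have h1 : ∀ π : Fin k → Perm (Fin n), (d : ℚ) ^ n * d ^ k * (if T π then
        ∑ a : Fin k → Fin n → ZMod d,
          (if (List.ofFn fun i => (⟨π i, a i⟩ : GenPerm d n)).prod.weight =
              (c : GenPerm d n).weight ∧ ∀ i, ∑ j, a i j = 0 then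
            ∏ i, x i ^ (⟨π i, a i⟩ : GenPerm d n).fixDim else 0) else 0) =
      d ^ (k * n + 1) * ∑ ε : Fin k → Bool, ((∏ i, e (ε i)) *
        if T π then ∏ i, y i (ε i) ^ cycleCount (π i) else 0) := fun π => by
    split_ifs with hπ
    · exact hlift π hπ
    · simp
  rw [Finset.sum_congr rfl fun π _ => h1 π, ← Finset.mul_sum, Finset.sum_comm, mul_left_comm,
    Finset.mul_sum]
  congr 1
  simp only [← Finset.mul_sum, mul_left_comm (n.factorial : ℚ), hF]
  simp only [Finset.mul_sum]
  rw [Finset.sum_comm]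
  refine Finset.sum_congr rfl fun t _ => ?_
  rw [Finset.sum_congr rfl fun ε _ => mul_left_comm _ _ _, ← Finset.mul_sum]
  congr 1
  -- For fixed `t` the sum over `ε` folds back into a product over the factors.
  have h2 := Finset.prod_univ_sum (fun _ : Fin k => (Finset.univ : Finset Bool))
    (fun i ε => e ε * (y i ε * ∏ j ∈ Finset.range (n - 1), (y i ε - t + 1 + j)))
  rw [Fintype.piFinset_univ] at h2
  simp only [← Finset.prod_mul_distrib]
  rw [← h2]
  simp [e, y]

/-! ### Change of basis to the polynomials `P_p`, and the coefficients `M`. -/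

theorem ring_choose_eq_prod (a : ℚ) (n : ℕ) :
    Ring.choose a n = (∏ l ∈ Finset.range n, (a - l)) / n.factorial := by
  rw [eq_div_iff (by positivity), mul_comm, ← nsmul_eq_mul,
    ← Ring.descPochhammer_eq_factorial_smul_choose, ← Polynomial.aeval_eq_smeval,
    Polynomial.aeval_def, Polynomial.eval₂_eq_eval_map, descPochhammer_map,
    descPochhammer_eval_eq_prod_range]

/-- The product is `N!` times the binomial of `(y - 1) + (N + 1 - t)` over `N`, expanded by
Vandermonde. -/
theorem prod_shift_eq_sum (N t : ℕ) (ht : t ≤ N + 1) (y : ℚ) :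
    ∏ j ∈ Finset.range N, (y - t + 1 + j) = N.factorial * ∑ i ∈ Finset.range (N + 1),
      Ring.choose (y - 1) i * ((N + 1 - t).choose (N - i) : ℚ) := by
  have h1 : ∏ j ∈ Finset.range N, (y - t + 1 + j) =
      N.factorial * Ring.choose (y - 1 + ((N + 1 - t : ℕ) : ℚ)) N := by
    rw [ring_choose_eq_prod, mul_div_cancel₀ _ (by positivity), ← Finset.prod_range_reflect]
    refine Finset.prod_congr rfl fun j hj => ?_
    have := Finset.mem_range.1 hj
    rw [Nat.cast_sub ht, Nat.cast_sub (by omega), Nat.cast_sub (by omega)]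
    push_cast
    ring
  rw [h1, Ring.add_choose_eq _ (Commute.all _ _), Finset.Nat.sum_antidiagonal_eq_sum_range_succ_mk]
  simp only [Ring.choose_natCast]

theorem mul_ring_choose_sub_one (z : ℚ) (i : ℕ) :
    z * Ring.choose (z - 1) i = (z - i) * Ring.choose z i := by
  have h : z * ∏ l ∈ Finset.range i, (z - 1 - l) = (z - i) * ∏ l ∈ Finset.range i, (z - l) := by
    have h1 := Finset.prod_range_succ (fun l : ℕ => z - l) i
    rw [Finset.prod_range_succ'] at h1
    rw [mul_comm (z - i), ← h1, mul_comm]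
    push_cast
    congr 1
    · exact Finset.prod_congr rfl fun l _ => by ring
    · ring
  rw [ring_choose_eq_prod, ring_choose_eq_prod, mul_div_assoc', h, mul_div_assoc']

/-- The normalized basis polynomial `P_{p+1}(x) / (d ^ p p!)`. -/
noncomputable def normP (d i : ℕ) (x : ℚ) : ℚ :=
  1 / ((d : ℚ) ^ i * i.factorial) * (polyP d (i + 1)).eval x

theorem normP_eq (d i : ℕ) (hd : (d : ℚ) ≠ 0) (x : ℚ) :
    normP d i x = Ring.choose ((x - 1) / d) i * (x - i * (d - 1)) := by
  have h : (stepFalling d i).eval x = d ^ i * ∏ l ∈ Finset.range i, ((x - 1) / d - l) := by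
    rw [stepFalling, Polynomial.eval_prod, ← Finset.card_range i, ← Finset.prod_const,
      Finset.card_range, ← Finset.prod_mul_distrib]
    refine Finset.prod_congr rfl fun l _ => ?_
    simp only [Polynomial.eval_sub, Polynomial.eval_X, Polynomial.eval_C]
    field_simp
    ring
  have hi : (i.factorial : ℚ) ≠ 0 := by positivity
  have hdi : (d : ℚ) ^ i ≠ 0 := pow_ne_zero _ hd
  rw [normP, polyP, Polynomial.eval_mul, h, ring_choose_eq_prod]
  simp only [Polynomial.eval_sub, Polynomial.eval_X, Polynomial.eval_C]
  field_simp

/-- Put `z = (x - 1) / d`. Both evaluations have the same Vandermonde coefficients, and `(z + 1)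
C(z, i) + (d - 1) z C(z - 1, i) = (d z + 1 - i (d - 1)) C(z, i)`, where `d z + 1 = x`. This is the
origin of the linear factor of `P_p`. -/
theorem combined_shift_eq_sum {d : ℕ} (hd : (d : ℚ) ≠ 0) (N t : ℕ) (ht : t ≤ N + 1) (x : ℚ) :
    (x + d - 1) / d * (∏ j ∈ Finset.range N, ((x + d - 1) / d - t + 1 + j)) +
        (d - 1) * ((x - 1) / d * ∏ j ∈ Finset.range N, ((x - 1) / d - t + 1 + j)) =
      N.factorial * ∑ i ∈ Finset.range (N + 1), ((N + 1 - t).choose (N - i) : ℚ) *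
        normP d i x := by
  have hy : (x + d - 1) / d = (x - 1) / d + 1 := by field_simp; ring
  have hx : x = d * ((x - 1) / d) + 1 := by field_simp; ring
  rw [prod_shift_eq_sum N t ht, prod_shift_eq_sum N t ht, hy, add_sub_cancel_right]
  simp only [normP_eq d _ hd]
  generalize (x - 1) / d = z at hx
  subst hx
  simp only [Finset.mul_sum]
  rw [← Finset.sum_add_distrib]
  refine Finset.sum_congr rfl fun i _ => ?_
  linear_combination ((d : ℚ) - 1) * N.factorial * ((N + 1 - t).choose (N - i) : ℚ) *
    mul_ring_choose_sub_one z i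

/-- With the complementary lower index `n - p i` the terms beyond the minimum vanish by themselves,
so the range of `t` no longer depends on `p`. -/
theorem coeffM_eq_sum (n : ℕ) {k : ℕ} (hk : 1 ≤ k) (p : Fin k → ℕ) (hp : ∀ i, p i ≤ n) :
    (coeffM n p : ℚ) = ∑ t ∈ Finset.range (n + 1), (-1) ^ t * (n.choose t : ℚ) *
      ∏ i, ((n - t).choose (n - p i) : ℚ) := by
  have : Nonempty (Fin k) := ⟨⟨0, hk⟩⟩
  have hle : ∀ i, (⨅ i, p i) ≤ p i := fun i => ciInf_le (OrderBot.bddBelow _) i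
  obtain ⟨i₀, hi₀⟩ := exists_eq_ciInf_of_finite (f := p)
  rw [coeffM]
  refine Eq.trans ?_ (Finset.sum_subset (s₁ := Finset.range ((⨅ i, p i) + 1)) ?_ ?_)
  · push_cast
    refine Finset.sum_congr rfl fun t ht => ?_
    congr 1
    refine Finset.prod_congr rfl fun i _ => ?_
    have h1 := hle i
    have h2 := hp i
    have h3 := Finset.mem_range.1 ht
    rw [← Nat.choose_symm (by omega : p i - t ≤ n - t)]
    congr 2
    omega
  · refine Finset.range_mono ?_
    have h1 := hp i₀
    omega
  · intro t ht ht'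
    simp only [Finset.mem_range] at ht ht'
    rw [Finset.prod_eq_zero (Finset.mem_univ i₀), mul_zero]
    rw [Nat.choose_eq_zero_of_lt (by omega), Nat.cast_zero]

theorem sum_alternating_choose_succ (p : ℕ) (f : ℕ → ℚ) :
    ∑ t ∈ Finset.range (p + 2), (-1) ^ t * ((p + 1).choose t : ℚ) * f t =
      ∑ t ∈ Finset.range (p + 1), (-1) ^ t * (p.choose t : ℚ) * (f t - f (t + 1)) := by
  have h : ∑ t ∈ Finset.range (p + 1), (-1) ^ t * (p.choose t : ℚ) * f t =
      ∑ t ∈ Finset.range (p + 1), (-1) ^ (t + 1) * (p.choose (t + 1) : ℚ) * f (t + 1) + f 0 := by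
    have h1 := Finset.sum_range_succ (fun t => (-1) ^ t * (p.choose t : ℚ) * f t) (p + 1)
    rw [Finset.sum_range_succ', Nat.choose_succ_self] at h1
    simpa using h1.symm
  simp only [mul_sub]
  rw [Finset.sum_sub_distrib, h, Finset.sum_range_succ']
  simp only [Nat.choose_succ_succ, pow_zero, Nat.choose_zero_right, Nat.cast_one, one_mul,
    Nat.cast_add]
  rw [add_sub_right_comm, ← Finset.sum_sub_distrib]
  congr 1
  exact Finset.sum_congr rfl fun t _ => by ring

/-- A `p`-th finite difference of a binomial coefficient: each difference lowers both indices by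
one. -/
theorem sum_alternating_choose_mul_choose (p N m : ℕ) :
    ∑ t ∈ Finset.range (p + 1), (-1) ^ t * (p.choose t : ℚ) * ((N + p - t).choose m : ℚ) =
      if p ≤ m then (N.choose (m - p) : ℚ) else 0 := by
  induction p generalizing m with
  | zero => simp
  | succ p ih =>
    rw [sum_alternating_choose_succ p (fun t => ((N + (p + 1) - t).choose m : ℚ))]
    rcases m with _ | m
    · simp
    · have h := ih m
      rw [Nat.add_sub_add_right]
      simp only [Nat.add_le_add_iff_right]
      rw [← h]
      refine Finset.sum_congr rfl fun t ht => ?_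
      have h1 := Finset.mem_range.1 ht
      rw [show N + (p + 1) - t = (N + p - t) + 1 by omega,
        show N + (p + 1) - (t + 1) = N + p - t by omega, Nat.choose_succ_succ]
      push_cast
      ring

/-- Since `C(n, t) C(n - t, n - p) = C(n, p) C(p, t)`, the sum is `C(n, p)` times a `p`-th
difference, which equals `C(n - p, q)` or vanishes. -/
theorem coeffM_pair (n p q : ℕ) (hp : p ≤ n) (hq : q ≤ n) :
    (coeffM n ![p, q] : ℚ) = if p + q ≤ n then
      (n.factorial : ℚ) / (p.factorial * q.factorial * (n - p - q).factorial) else 0 := by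
  rw [coeffM_eq_sum n (by norm_num) _ (by intro i; fin_cases i <;> simpa)]
  have h1 : ∑ t ∈ Finset.range (n + 1), (-1) ^ t * (n.choose t : ℚ) *
      ∏ i : Fin 2, ((n - t).choose (n - ![p, q] i) : ℚ) =
      (n.choose p : ℚ) * ∑ t ∈ Finset.range (p + 1), (-1) ^ t * (p.choose t : ℚ) *
        ((n - p + p - t).choose (n - q) : ℚ) := by
    rw [Finset.mul_sum, ← Finset.sum_subset (Finset.range_mono (show p + 1 ≤ n + 1 by omega))]
    · refine Finset.sum_congr rfl fun t ht => ?_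
      have ht' := Finset.mem_range.1 ht
      have h2 := Nat.choose_mul (n := n) (k := p) (s := t) (by omega)
      rw [← Nat.choose_symm (by omega : p - t ≤ n - t),
        show n - t - (p - t) = n - p by omega] at h2
      have h3 : (n.choose p : ℚ) * p.choose t = n.choose t * (n - t).choose (n - p) := by
        exact_mod_cast h2
      simp only [Fin.prod_univ_two, Matrix.cons_val_zero, Matrix.cons_val_one]
      rw [show n - p + p - t = n - t by omega]
      linear_combination -(-1 : ℚ) ^ t * ((n - t).choose (n - q) : ℚ) * h3
    · intro t ht ht'
      simp only [Finset.mem_range] at ht ht'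
      simp [Fin.prod_univ_two, Nat.choose_eq_zero_of_lt (show n - t < n - p by omega)]
  rw [h1, sum_alternating_choose_mul_choose]
  by_cases hpq : p + q ≤ n
  · rw [if_pos (by omega), if_pos hpq, Nat.cast_choose ℚ hp, Nat.cast_choose ℚ (by omega),
      show n - p - (n - q - p) = q by omega, show n - q - p = n - p - q by omega]
    have : ((n - p).factorial : ℚ) ≠ 0 := by positivity
    field_simp
  · rw [if_neg (by omega), if_neg hpq, mul_zero]

/-! ### Generating functions and the polynomial identities. -/

/-- The sum of `∏ i, x i ^ dim Fix (u i)` over the transitive factorizations `c = u_1 ⋯ u_k`. -/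
noncomputable def transFactEnum [NeZero d] (c : Gddn d n) {k : ℕ} (x : Fin k → ℚ) : ℚ :=
  ∑ u : Fin k → Gddn d n, open Classical in if (List.ofFn u).prod = c ∧
    MulAction.IsPretransitive (Subgroup.closure (Set.range u)) (Fin n × ZMod d) then
    ∏ i, x i ^ (u i : GenPerm d n).fixDim else 0

theorem sum_transFactCount [NeZero d] (c : Gddn d n) {k : ℕ} (x : Fin k → ℚ) :
    ∑ r ∈ Fintype.piFinset fun _ : Fin k => Finset.range (n + 1),
      (transFactCount c r : ℚ) * ∏ i, x i ^ r i = transFactEnum c x := by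
  classical
  rw [transFactEnum, ← Finset.sum_fiberwise_of_maps_to
    (g := fun (u : Fin k → Gddn d n) i => (u i : GenPerm d n).fixDim)
    (t := Fintype.piFinset fun _ : Fin k => Finset.range (n + 1))
    (fun u _ => Fintype.mem_piFinset.2 fun i =>
      Finset.mem_range.2 (Nat.lt_succ_of_le (GenPerm.fixDim_le _)))]
  refine Finset.sum_congr rfl fun r _ => ?_
  rw [transFactCount, Nat.card_eq_fintype_card, Fintype.card_subtype, ← Finset.sum_filter,
    Finset.filter_filter, Finset.sum_congr rfl (g := fun _ => ∏ i, x i ^ r i) (fun u hu => by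
      rw [← (Finset.mem_filter.1 hu).2.1]), Finset.sum_const, nsmul_eq_mul]
  congr 3
  ext u
  simp only [Finset.mem_filter, Finset.mem_univ, true_and, funext_iff]
  tauto

theorem transFactEnum_eq [NeZero d] (hn : 2 ≤ n) (c : Gddn d n) (hc : IsCoxeterElement d n hn c)
    {k : ℕ} (hk : 1 ≤ k) (x : Fin k → ℚ) :
    (n : ℚ) ^ k / (Nat.card (Gddn d n) : ℚ) ^ (k - 1) * transFactEnum c x =
      ∑ p ∈ Fintype.piFinset fun _ : Fin k => Finset.Icc 1 n,
        (coeffM n p : ℚ) * ∏ i, normP d (p i - 1) (x i) := by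
  have hd0 : (d : ℚ) ≠ 0 := Nat.cast_ne_zero.2 (NeZero.ne d)
  have hn0 : NeZero n := ⟨by omega⟩
  obtain ⟨N, rfl⟩ : ∃ N, n = N + 1 := ⟨n - 1, by omega⟩
  obtain ⟨l, rfl⟩ : ∃ l, k = l + 1 := ⟨k - 1, by omega⟩
  set T := ∑ p ∈ Fintype.piFinset fun _ : Fin (l + 1) => Finset.Icc 1 (N + 1),
    (coeffM (N + 1) p : ℚ) * ∏ i, normP d (p i - 1) (x i) with hT
  have hsum : ∑ t ∈ Finset.range (N + 1 + 1), (-1) ^ t * ((N + 1).choose t : ℚ) *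
        ∏ i, ((x i + d - 1) / d *
          (∏ j ∈ Finset.range (N + 1 - 1), ((x i + d - 1) / d - t + 1 + j)) +
          (d - 1) * ((x i - 1) / d *
            ∏ j ∈ Finset.range (N + 1 - 1), ((x i - 1) / d - t + 1 + j))) =
      (N.factorial : ℚ) ^ (l + 1) * T := by
    have hshift : ∀ (t : ℕ) (y : ℚ), ∑ i ∈ Finset.range (N + 1),
        ((N + 1 - t).choose (N - i) : ℚ) * normP d i y =
        ∑ p ∈ Finset.Icc 1 (N + 1), ((N + 1 - t).choose (N + 1 - p) : ℚ) * normP d (p - 1) y :=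
      fun t y => by
        refine Finset.sum_nbij' (· + 1) (· - 1) ?_ ?_ ?_ ?_ ?_
        · intro i hi
          simp only [Finset.mem_range, Finset.mem_Icc] at hi ⊢
          omega
        · intro p hp
          simp only [Finset.mem_range, Finset.mem_Icc] at hp ⊢
          omega
        · intro i _
          simp
        · intro p hp
          simp only [Finset.mem_Icc] at hp
          omega
        · intro i _
          simp
    have h1 : ∀ t ∈ Finset.range (N + 1 + 1), (-1) ^ t * ((N + 1).choose t : ℚ) *
        ∏ i, ((x i + d - 1) / d *
          (∏ j ∈ Finset.range (N + 1 - 1), ((x i + d - 1) / d - t + 1 + j)) +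
          (d - 1) * ((x i - 1) / d *
            ∏ j ∈ Finset.range (N + 1 - 1), ((x i - 1) / d - t + 1 + j))) =
        (N.factorial : ℚ) ^ (l + 1) * ∑ p ∈ Fintype.piFinset fun _ : Fin (l + 1) =>
          Finset.Icc 1 (N + 1), (-1) ^ t * ((N + 1).choose t : ℚ) *
            (∏ i, ((N + 1 - t).choose (N + 1 - p i) : ℚ)) * ∏ i, normP d (p i - 1) (x i) := by
      intro t ht
      have ht' := Finset.mem_range.1 ht
      simp only [Nat.add_sub_cancel, combined_shift_eq_sum hd0 N t (by omega), hshift]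
      rw [Finset.prod_mul_distrib, Finset.prod_univ_sum]
      simp only [Finset.prod_mul_distrib, Finset.prod_const, Finset.card_univ, Fintype.card_fin,
        mul_assoc]
      rw [mul_left_comm, ← Finset.mul_sum, ← Finset.mul_sum]
      ring
    rw [Finset.sum_congr rfl h1, ← Finset.mul_sum, Finset.sum_comm, hT]
    congr 1
    refine Finset.sum_congr rfl fun p hp => ?_
    rw [coeffM_eq_sum (N + 1) hk p
      (fun i => (Finset.mem_Icc.1 (Fintype.mem_piFinset.1 hp i)).2), Finset.sum_mul]
  have key := sum_transitive_factorizations_Gddn hn c hc x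
  rw [hsum] at key
  change _ * transFactEnum c x = _ at key
  -- The order of the group absorbs the remaining powers of `d` and the factorials in `key`.
  have hG : (d : ℚ) * Nat.card (Gddn d (N + 1)) = d ^ (N + 1) * (N + 1).factorial := by
    exact_mod_cast card_Gddn (d := d) (n := N + 1)
  have hG0 : (Nat.card (Gddn d (N + 1)) : ℚ) ≠ 0 := by
    intro h
    rw [h, mul_zero] at hG
    exact (mul_ne_zero (pow_ne_zero _ hd0)
      (Nat.cast_ne_zero.2 (Nat.factorial_ne_zero _))) hG.symm
  have hfac : ((N + 1).factorial : ℚ) = ((N + 1 : ℕ) : ℚ) * N.factorial := by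
    rw [Nat.factorial_succ, Nat.cast_mul]
  have hne : ((N + 1).factorial : ℚ) * (d : ℚ) ^ (N + 1) * d ^ (l + 1) ≠ 0 :=
    mul_ne_zero (mul_ne_zero (Nat.cast_ne_zero.2 (Nat.factorial_ne_zero _)) (pow_ne_zero _ hd0))
      (pow_ne_zero _ hd0)
  rw [Nat.add_sub_cancel, div_mul_eq_mul_div, div_eq_iff (pow_ne_zero _ hG0)]
  refine mul_left_cancel₀ hne ?_
  calc ((N + 1).factorial : ℚ) * (d : ℚ) ^ (N + 1) * d ^ (l + 1) *
        (((N + 1 : ℕ) : ℚ) ^ (l + 1) * transFactEnum c x)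
      = ((N + 1 : ℕ) : ℚ) ^ (l + 1) * (d ^ ((l + 1) * (N + 1) + 1) *
          ((N.factorial : ℚ) ^ (l + 1) * T)) := by rw [← key]; ring
    _ = d ^ ((l + 1) * (N + 1) + 1) * ((N + 1).factorial : ℚ) ^ (l + 1) * T := by
        rw [hfac, mul_pow]; ring
    _ = ((N + 1).factorial : ℚ) * (d : ℚ) ^ (N + 1) * d *
          ((d : ℚ) ^ (N + 1) * (N + 1).factorial) ^ l * T := by ring
    _ = _ := by rw [← hG]; ring

theorem eval_aeval_X {σ : Type*} (x : σ → ℚ) (i : σ) (P : Polynomial ℚ) :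
    MvPolynomial.eval x (Polynomial.aeval (MvPolynomial.X i : MvPolynomial σ ℚ) P) =
      P.eval (x i) := by
  induction P using Polynomial.induction_on' with
  | add p q hp hq => rw [map_add, map_add, hp, hq, Polynomial.eval_add]
  | monomial m c => simp [Polynomial.aeval_monomial, MvPolynomial.algebraMap_eq]

theorem normP_pred {p : ℕ} (hp : 1 ≤ p) (x : ℚ) :
    normP d (p - 1) x = 1 / ((d : ℚ) ^ (p - 1) * ((p - 1).factorial : ℚ)) *
      (polyP d p).eval x := by
  rw [normP, Nat.sub_add_cancel hp]

theorem transFactCount_polynomial_identity [NeZero d] (hn : 2 ≤ n) (c : Gddn d n)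
    (hc : IsCoxeterElement d n hn c) {k : ℕ} (hk : 1 ≤ k) :
    MvPolynomial.C ((n : ℚ) ^ k / (Nat.card (Gddn d n) : ℚ) ^ (k - 1)) *
        ∑ᶠ r : Fin k → ℕ, MvPolynomial.C (transFactCount c r : ℚ) *
          ∏ i, (MvPolynomial.X i ^ r i : MvPolynomial (Fin k) ℚ)
      = ∑ᶠ (p : Fin k → ℕ) (_ : ∀ i, 1 ≤ p i),
          MvPolynomial.C (coeffM n p : ℚ) *
            ∏ i, (MvPolynomial.C (1 / ((d : ℚ) ^ (p i - 1) * ((p i - 1).factorial : ℚ))) *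
              Polynomial.aeval (MvPolynomial.X i : MvPolynomial (Fin k) ℚ) (polyP d (p i))) := by
  classical
  rw [finsum_eq_sum_of_support_subset (s := Fintype.piFinset fun _ : Fin k => Finset.range (n + 1)),
    finsum_eq_sum_of_support_subset (s := Fintype.piFinset fun _ : Fin k => Finset.Icc 1 n)]
  -- Over an infinite field it suffices to compare values at all rational points.
  · refine MvPolynomial.funext fun x => ?_
    simp only [map_mul, map_sum, MvPolynomial.eval_C, map_prod, map_pow, MvPolynomial.eval_X,
      sum_transFactCount, transFactEnum_eq hn c hc hk]
    refine Finset.sum_congr rfl fun p hp => ?_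
    have hp' : ∀ i, 1 ≤ p i := fun i => (Finset.mem_Icc.1 (Fintype.mem_piFinset.1 hp i)).1
    rw [finsum_eq_if, if_pos hp']
    simp only [map_mul, MvPolynomial.eval_C, map_prod, eval_aeval_X]
    congr 1
    exact Finset.prod_congr rfl fun i _ => normP_pred (hp' i) _
  · intro p hp
    rw [Function.mem_support, finsum_eq_if] at hp
    have h1 : ∀ i, 1 ≤ p i := by
      by_contra h
      exact hp (if_neg h)
    rw [if_pos h1] at hp
    refine Fintype.mem_piFinset.2 fun i => Finset.mem_Icc.2 ⟨h1 i, ?_⟩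
    by_contra h
    exact hp (by rw [coeffM_eq_zero n p i (by omega)]; simp)
  · intro r hr
    refine Fintype.mem_piFinset.2 fun i => Finset.mem_range.2 ?_
    by_contra h
    exact hr (by simp only [transFactCount_eq_zero c r i (by omega)]; simp)

theorem sum_piFinset_two (s : Finset ℕ) (f : (Fin 2 → ℕ) → ℚ) :
    ∑ r ∈ Fintype.piFinset fun _ : Fin 2 => s, f r = ∑ a ∈ s, ∑ b ∈ s, f ![a, b] := by
  rw [← Finset.sum_product']
  refine Finset.sum_bij' (fun r _ => (r 0, r 1)) (fun y _ => ![y.1, y.2]) ?_ ?_ ?_ ?_ ?_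
  · intro r hr
    exact Finset.mem_product.2 ⟨Fintype.mem_piFinset.1 hr 0, Fintype.mem_piFinset.1 hr 1⟩
  · intro y hy
    refine Fintype.mem_piFinset.2 fun i => ?_
    fin_cases i
    · exact (Finset.mem_product.1 hy).1
    · exact (Finset.mem_product.1 hy).2
  · intro r _
    ext i
    fin_cases i <;> rfl
  · intro y _
    rfl
  · intro r _
    congr 1
    ext i
    fin_cases i <;> rfl

/-- Dividing by `n (n - 1)` turns `n!` into `(n - 2)!`, and the factors `p` and `q` turn `(p - 1)!`
and `(q - 1)!` into `p!` and `q!`. This matches the two normalizations of the theorem. -/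
theorem coeffM_pair_eq_trinomial (hn : 2 ≤ n) {p q : ℕ} (hp : 1 ≤ p) (hq : 1 ≤ q) (hpn : p ≤ n)
    (hqn : q ≤ n) : (coeffM n ![p, q] : ℚ) / ((n : ℚ) * (n - 1)) =
      trinomial (n - 2) (p - 1) (q - 1) / ((p : ℚ) * q) := by
  rw [coeffM_pair n p q hpn hqn, trinomial]
  obtain ⟨N, rfl⟩ : ∃ N, n = N + 2 := ⟨n - 2, by omega⟩
  obtain ⟨a, rfl⟩ : ∃ a, p = a + 1 := ⟨p - 1, by omega⟩
  obtain ⟨b, rfl⟩ : ∃ b, q = b + 1 := ⟨q - 1, by omega⟩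
  by_cases h : a + b ≤ N
  · rw [if_pos (by omega), if_pos (by omega)]
    simp only [Nat.add_sub_cancel]
    rw [show N + 2 - (a + 1) - (b + 1) = N - a - b by omega, Nat.factorial_succ (N + 1),
      Nat.factorial_succ N, Nat.factorial_succ a, Nat.factorial_succ b]
    have h1 : (N : ℚ) + 2 - 1 ≠ 0 := by
      have : (0 : ℚ) ≤ N := by positivity
      linarith
    push_cast
    field_simp
    ring
  · rw [if_neg (by omega), if_neg (by omega)]
    simp

theorem transFactCount_pair_polynomial_identity [NeZero d] (hn : 2 ≤ n) (c : Gddn d n)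
    (hc : IsCoxeterElement d n hn c) :
    MvPolynomial.C ((n : ℚ) / (((n : ℚ) - 1) * (Nat.card (Gddn d n) : ℚ))) *
        ∑ᶠ (r : ℕ) (s : ℕ), MvPolynomial.C (transFactCount c ![r, s] : ℚ) *
          (MvPolynomial.X 0 ^ r * MvPolynomial.X 1 ^ s : MvPolynomial (Fin 2) ℚ)
      = ∑ᶠ (p : ℕ) (q : ℕ) (_ : 1 ≤ p ∧ 1 ≤ q),
          MvPolynomial.C (trinomial (n - 2) (p - 1) (q - 1) /
              ((d : ℚ) ^ (p - 1) * (p.factorial : ℚ) *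
                ((d : ℚ) ^ (q - 1) * (q.factorial : ℚ)))) *
            (Polynomial.aeval (MvPolynomial.X 0 : MvPolynomial (Fin 2) ℚ) (polyP d p) *
              Polynomial.aeval (MvPolynomial.X 1 : MvPolynomial (Fin 2) ℚ) (polyP d q)) := by
  classical
  have hL : ∑ᶠ (r : ℕ) (s : ℕ), MvPolynomial.C (transFactCount c ![r, s] : ℚ) *
          (MvPolynomial.X 0 ^ r * MvPolynomial.X 1 ^ s : MvPolynomial (Fin 2) ℚ) =
      ∑ r ∈ Finset.range (n + 1), ∑ s ∈ Finset.range (n + 1),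
        MvPolynomial.C (transFactCount c ![r, s] : ℚ) *
          (MvPolynomial.X 0 ^ r * MvPolynomial.X 1 ^ s : MvPolynomial (Fin 2) ℚ) := by
    have hin : ∀ r, ∑ᶠ s : ℕ, MvPolynomial.C (transFactCount c ![r, s] : ℚ) *
          (MvPolynomial.X 0 ^ r * MvPolynomial.X 1 ^ s : MvPolynomial (Fin 2) ℚ) =
        ∑ s ∈ Finset.range (n + 1), MvPolynomial.C (transFactCount c ![r, s] : ℚ) *
          (MvPolynomial.X 0 ^ r * MvPolynomial.X 1 ^ s : MvPolynomial (Fin 2) ℚ) := fun r => by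
      refine finsum_eq_sum_of_support_subset _ fun s hs => Finset.mem_coe.2 (Finset.mem_range.2 ?_)
      by_contra h
      exact hs (by
        simp only [transFactCount_eq_zero c ![r, s] 1 (by simp; omega)]; simp)
    simp only [hin]
    refine finsum_eq_sum_of_support_subset _ fun r hr => Finset.mem_coe.2 (Finset.mem_range.2 ?_)
    by_contra h
    exact hr (Finset.sum_eq_zero fun s _ => by
      simp only [transFactCount_eq_zero c ![r, s] 0 (by simp; omega)]; simp)
  have hR : ∑ᶠ (p : ℕ) (q : ℕ) (_ : 1 ≤ p ∧ 1 ≤ q),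
          MvPolynomial.C (trinomial (n - 2) (p - 1) (q - 1) /
              ((d : ℚ) ^ (p - 1) * (p.factorial : ℚ) *
                ((d : ℚ) ^ (q - 1) * (q.factorial : ℚ)))) *
            (Polynomial.aeval (MvPolynomial.X 0 : MvPolynomial (Fin 2) ℚ) (polyP d p) *
              Polynomial.aeval (MvPolynomial.X 1 : MvPolynomial (Fin 2) ℚ) (polyP d q)) =
      ∑ p ∈ Finset.Icc 1 n, ∑ q ∈ Finset.Icc 1 n,
          MvPolynomial.C (trinomial (n - 2) (p - 1) (q - 1) /
              ((d : ℚ) ^ (p - 1) * (p.factorial : ℚ) *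
                ((d : ℚ) ^ (q - 1) * (q.factorial : ℚ)))) *
            (Polynomial.aeval (MvPolynomial.X 0 : MvPolynomial (Fin 2) ℚ) (polyP d p) *
              Polynomial.aeval (MvPolynomial.X 1 : MvPolynomial (Fin 2) ℚ) (polyP d q)) := by
    have htri : ∀ p q, n < p ∨ n < q → trinomial (n - 2) (p - 1) (q - 1) = 0 := fun p q h =>
      if_neg (by omega)
    simp only [finsum_eq_if]
    have hin : ∀ p, ∑ᶠ q : ℕ, (if 1 ≤ p ∧ 1 ≤ q then
          MvPolynomial.C (trinomial (n - 2) (p - 1) (q - 1) /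
              ((d : ℚ) ^ (p - 1) * (p.factorial : ℚ) *
                ((d : ℚ) ^ (q - 1) * (q.factorial : ℚ)))) *
            (Polynomial.aeval (MvPolynomial.X 0 : MvPolynomial (Fin 2) ℚ) (polyP d p) *
              Polynomial.aeval (MvPolynomial.X 1 : MvPolynomial (Fin 2) ℚ) (polyP d q)) else 0) =
        ∑ q ∈ Finset.Icc 1 n, (if 1 ≤ p ∧ 1 ≤ q then
          MvPolynomial.C (trinomial (n - 2) (p - 1) (q - 1) /
              ((d : ℚ) ^ (p - 1) * (p.factorial : ℚ) *
                ((d : ℚ) ^ (q - 1) * (q.factorial : ℚ)))) *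
            (Polynomial.aeval (MvPolynomial.X 0 : MvPolynomial (Fin 2) ℚ) (polyP d p) *
              Polynomial.aeval (MvPolynomial.X 1 : MvPolynomial (Fin 2) ℚ) (polyP d q))
          else 0) := fun p => by
      refine finsum_eq_sum_of_support_subset _ fun q hq => Finset.mem_coe.2 (Finset.mem_Icc.2 ?_)
      by_contra h
      refine hq ?_
      by_cases hpq : 1 ≤ p ∧ 1 ≤ q
      · simp [htri p q (by omega)]
      · exact if_neg hpq
    simp only [hin]
    rw [finsum_eq_sum_of_support_subset (s := Finset.Icc 1 n)]
    · refine Finset.sum_congr rfl fun p hp => Finset.sum_congr rfl fun q hq => if_pos ?_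
      exact ⟨(Finset.mem_Icc.1 hp).1, (Finset.mem_Icc.1 hq).1⟩
    · refine fun p hp => Finset.mem_coe.2 (Finset.mem_Icc.2 ?_)
      by_contra h
      refine hp (Finset.sum_eq_zero fun q _ => ?_)
      by_cases hpq : 1 ≤ p ∧ 1 ≤ q
      · simp [htri p q (by omega)]
      · exact if_neg hpq
  rw [hL, hR]
  refine MvPolynomial.funext fun x => ?_
  simp only [map_mul, map_sum, MvPolynomial.eval_C, map_pow, MvPolynomial.eval_X, eval_aeval_X]
  have hcount := sum_transFactCount c x
  have henum := transFactEnum_eq hn c hc (by norm_num : 1 ≤ 2) x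
  rw [sum_piFinset_two] at hcount henum
  simp only [Fin.prod_univ_two, Matrix.cons_val_zero, Matrix.cons_val_one] at hcount henum
  have hn1 : ((n : ℚ) - 1) ≠ 0 := by
    have : (2 : ℚ) ≤ n := by exact_mod_cast hn
    linarith
  have hn0 : (n : ℚ) ≠ 0 := Nat.cast_ne_zero.2 (by omega)
  have hconst : (n : ℚ) / (((n : ℚ) - 1) * (Nat.card (Gddn d n) : ℚ)) =
      ((n : ℚ) * (n - 1))⁻¹ * ((n : ℚ) ^ 2 / (Nat.card (Gddn d n) : ℚ) ^ (2 - 1)) := by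
    rw [Nat.add_one_sub_one, pow_one, div_eq_mul_inv, div_eq_mul_inv, mul_inv, mul_inv]
    field_simp
  rw [hcount, hconst, mul_assoc, henum, Finset.mul_sum]
  refine Finset.sum_congr rfl fun p hp => ?_
  rw [Finset.mul_sum]
  refine Finset.sum_congr rfl fun q hq => ?_
  obtain ⟨hp1, hpn⟩ := Finset.mem_Icc.1 hp
  obtain ⟨hq1, hqn⟩ := Finset.mem_Icc.1 hq
  have h := coeffM_pair_eq_trinomial hn hp1 hq1 hpn hqn
  rw [normP_pred hp1, normP_pred hq1, ← mul_assoc, ← div_eq_inv_mul, h]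
  have hfac : ∀ m : ℕ, 1 ≤ m → (m.factorial : ℚ) = m * (m - 1).factorial := fun m hm => by
    rw [← Nat.mul_factorial_pred (by omega)]
    push_cast
    rfl
  rw [hfac p hp1, hfac q hq1]
  simp only [div_eq_mul_inv, mul_inv, one_mul]
  ring

end CoxeterFactorizations

end TransitiveFactorizations

theorem theorem1p4 (d n : ℕ) (hd : 1 < d) (hn : 2 ≤ n) (c : Gddn d n)
    (hc : IsCoxeterElement d n hn c) :
    -- two factors
    (MvPolynomial.C ((n : ℚ) / (((n : ℚ) - 1) * (Nat.card (Gddn d n) : ℚ))) *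
        ∑ᶠ (r : ℕ) (s : ℕ), MvPolynomial.C (transFactCount c ![r, s] : ℚ) *
          (MvPolynomial.X 0 ^ r * MvPolynomial.X 1 ^ s : MvPolynomial (Fin 2) ℚ)
      = ∑ᶠ (p : ℕ) (q : ℕ) (_ : 1 ≤ p ∧ 1 ≤ q),
          MvPolynomial.C (trinomial (n - 2) (p - 1) (q - 1) /
              ((d : ℚ) ^ (p - 1) * (p.factorial : ℚ) *
                ((d : ℚ) ^ (q - 1) * (q.factorial : ℚ)))) *
            (Polynomial.aeval (MvPolynomial.X 0 : MvPolynomial (Fin 2) ℚ) (polyP d p) *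
              Polynomial.aeval (MvPolynomial.X 1 : MvPolynomial (Fin 2) ℚ) (polyP d q))) ∧
    -- `k` factors
    ∀ k : ℕ, 1 ≤ k →
      MvPolynomial.C ((n : ℚ) ^ k / (Nat.card (Gddn d n) : ℚ) ^ (k - 1)) *
        ∑ᶠ r : Fin k → ℕ, MvPolynomial.C (transFactCount c r : ℚ) *
          ∏ i, (MvPolynomial.X i ^ r i : MvPolynomial (Fin k) ℚ)
      = ∑ᶠ (p : Fin k → ℕ) (_ : ∀ i, 1 ≤ p i),
          MvPolynomial.C (coeffM n p : ℚ) *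
            ∏ i, (MvPolynomial.C (1 / ((d : ℚ) ^ (p i - 1) * ((p i - 1).factorial : ℚ))) *
              Polynomial.aeval (MvPolynomial.X i : MvPolynomial (Fin k) ℚ) (polyP d (p i))) := by
  have hd0 : NeZero d := ⟨by omega⟩
  exact ⟨transFactCount_pair_polynomial_identity hn c hc,
    fun k hk => transFactCount_polynomial_identity hn c hc hk⟩
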